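/- Let $n\ge 3$ and let $P_n^3$ be the $3$-uniform loose path with vertices $1,\dots,2n+1$ and edges $e_j=\{2j-1,2j,2j+1\}$, $1\le j\le n$. Its adjacency hypermatrix $A$ has entry $A_{uvw}=\tfrac12$ if $\{u,v,w\}$ is an edge and $A_{uvw}=0$ otherwise, and its nullvariety is $$V_0=\{x\in\mathbb C^{2n+1} : \nabla(Ax^3)=0\},\qquad Ax^3=\sum_{u,v,w}A_{uvw}x_ux_vx_w .$$ Put $p_a=x_{a-2}x_{a-1}+x_{a+1}x_{a+2}$, $A'_n=\{3,5,\dots,2n-1\}$ and $A_n=A'_n\setminus\{3,2n-1\}$. Let $\mathcal F_n$ be the collection of Fibonacci subsets of $A'_n$, that is, the sets $S\subseteq A'_n$ that contain at least one of $2k+1$, $2k+3$ for every $1\le k\le n-2$. For $S\in\mathcal F_n$, a set $B$ of polynomials is called $S$-admissible if $B=U_1\cup U_2\cup U_3\cup U_4$, where - $U_1=\{x_i : i\in S\}$; - $U_2=\{x_1,x_2\}$ if $3\notin S$, $5\in S$; $U_2$ is one of $\{x_1\}$, $\{x_2\}$ if $3,5\in S$; $U_2=\{p_3\}$ if $3\in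 S$, $5\notin S$; - $U_3=\{x_{2n},x_{2n+1}\}$ if $2n-1\notin S$, $2n-3\in S$; $U_3$ is one of $\{x_{2n}\}$, $\{x_{2n+1}\}$ if $2n-3,2n-1\in S$; $U_3=\{p_{2n-1}\}$ if $2n-1\in S$, $2n-3\notin S$; - $U_4$ is the union over $a\in A_n$ of the sets $\emptyset$ if $a-2,a+2\in S$; $\{x_{a+1}\}$ if $a-2\in S$, $a+2\notin S$; $\{x_{a-1}\}$ if $a-2\notin S$, $a+2\in S$; $\{p_a\}$ if $a-2,a+2\notin S$. Let $\mathcal I_n$ be the set of ideals of $\mathbb C[x_1,\dots,x_{2n+1}]$ generated by the $S$-admissible sets, $S\in\mathcal F_n$, and let $\mathcal J_n$ be the set of those $J\in\mathcal I_n$ for which the zero locus $\mathcal V(J)\subseteq\mathbb C^{2n+1}$ is inclusion-maximal among the varieties $\mathcal V(I)$, $I\in\mathcal I_n$. Then $$V_0=\bigcup_{J\in\mathcal J_n}\mathcal V(J),$$ and for each $J\in\mathcal J_n$ the variety $\mathcal V(J)$ is an irreducible component of $V_0$. Moreover, $\mathcal J_n$ consists exactly of the ideals generated by the $S$-admissible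 sets $B$ for those $S\in\mathcal F_n$ in which every maximal run of consecutive elements of $A'_n$ is a singleton or has even length. -/

import Mathlib

/-! ### Hypermatrices, eigenvarieties and hypergraphs -/

/-- A cubical hypermatrix over `ℂ` of order `k`, with index set `V`. -/
abbrev Hypermatrix (k : ℕ) (V : Type) : Type := (Fin k → V) → ℂ

namespace Hypermatrix

/-- The homogeneous `k`-form `M x^k = ∑ M_{i₁ ⋯ i_k} x_{i₁} ⋯ x_{i_k}`. -/
noncomputable def form {k : ℕ} {V : Type} [Fintype V] [DecidableEq V]
    (M : Hypermatrix k V) : MvPolynomial V ℂ :=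
  ∑ i : Fin k → V, MvPolynomial.C (M i) * ∏ j : Fin k, MvPolynomial.X (i j)

open Classical in
/-- The identity hypermatrix: `1` where all indices agree, `0` elsewhere. -/
noncomputable def identity (k : ℕ) (V : Type) : Hypermatrix k V :=
  fun i => if ∀ j j' : Fin k, i j = i j' then 1 else 0

/-- The affine eigenvariety of `M` at `μ`: all `x` with `∇ ((M - μ I) x^k) = 0`. -/
def eigenvariety {k : ℕ} {V : Type} [Fintype V] [DecidableEq V]
    (M : Hypermatrix k V) (μ : ℂ) : Set (V → ℂ) :=
  {x | ∀ v : V, MvPolynomial.eval x (MvPolynomial.pderiv v (form (M - μ • identity k V))) = 0}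

/-- The nullvariety is the eigenvariety of the eigenvalue `0`. -/
def nullvariety {k : ℕ} {V : Type} [Fintype V] [DecidableEq V]
    (M : Hypermatrix k V) : Set (V → ℂ) :=
  eigenvariety M 0

end Hypermatrix

open Classical in
/-- The adjacency hypermatrix of a hypergraph all of whose edges have `k` vertices:
the entry at `(v₁, …, v_k)` is `1 / (k - 1)!` if `{v₁, …, v_k}` is an edge, and `0` otherwise. -/
noncomputable def Hypergraph.adjacencyHypermatrix {V : Type} (H : Hypergraph V) (k : ℕ) :
    Hypermatrix k V :=
  fun i => if Set.range i ∈ H.edgeSet then 1 / ((k - 1).factorial : ℂ) else 0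

namespace LoosePath

/-- The vertices `1, …, 2 n + 1` of the 3-uniform loose path with `n` edges. -/
abbrev Vertex (n : ℕ) : Type := {i : ℕ // i ∈ Finset.Icc 1 (2 * n + 1)}

/-- The 3-uniform loose path `P_n^3`: its edges are
`e_j = {2 (j - 1) + 1, 2 (j - 1) + 2, 2 j + 1}` for `1 ≤ j ≤ n`. -/
def loosePath (n : ℕ) : Hypergraph (Vertex n) where
  vertexSet := Set.univ
  edgeSet := {e | ∃ j ∈ Finset.Icc 1 n,
    e = {v : Vertex n | 2 * (j - 1) + 1 ≤ v.1 ∧ v.1 ≤ 2 * j + 1}}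
  subset_vertexSet_of_mem_edgeSet' := fun _ _ => Set.subset_univ _

/-- The nullvariety `V₀` of `P_n^3`. -/
def nullvariety (n : ℕ) : Set (Vertex n → ℂ) :=
  Hypermatrix.nullvariety ((loosePath n).adjacencyHypermatrix 3)

/-! ### Affine varieties -/

/-- Affine varieties: zero loci of sets of polynomials (equivalently, of ideals). -/
def IsAffineVariety {σ : Type} (Z : Set (σ → ℂ)) : Prop :=
  ∃ I : Ideal (MvPolynomial σ ℂ), Z = MvPolynomial.zeroLocus ℂ I

/-- A nonempty affine variety that is not the union of two proper subvarieties. -/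
def IsIrreducibleVariety {σ : Type} (Z : Set (σ → ℂ)) : Prop :=
  IsAffineVariety Z ∧ Z.Nonempty ∧
    ∀ W₁ W₂ : Set (σ → ℂ), IsAffineVariety W₁ → IsAffineVariety W₂ →
      Z = W₁ ∪ W₂ → Z = W₁ ∨ Z = W₂

/-- The irreducible components of `Y` are the inclusion-maximal irreducible varieties in `Y`. -/
def IsIrreducibleComponent {σ : Type} (Z Y : Set (σ → ℂ)) : Prop :=
  Maximal (fun W : Set (σ → ℂ) => IsIrreducibleVariety W ∧ W ⊆ Y) Z

/-! ### Admissible sets of polynomials -/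

/-- The variable `x_i`, for `1 ≤ i ≤ 2 n + 1` (the only indices that are used). -/
noncomputable def x (n i : ℕ) : MvPolynomial (Vertex n) ℂ :=
  if h : i ∈ Finset.Icc 1 (2 * n + 1) then MvPolynomial.X ⟨i, h⟩ else 0

/-- The binomial `p_a = x_{a-2} x_{a-1} + x_{a+1} x_{a+2}`, for `3 ≤ a ≤ 2 n - 1`. -/
noncomputable def p (n a : ℕ) : MvPolynomial (Vertex n) ℂ :=
  x n (a - 2) * x n (a - 1) + x n (a + 1) * x n (a + 2)

/-- `A'_n = {3, 5, …, 2 n - 1}`. -/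
def A' (n : ℕ) : Finset ℕ := (Finset.Icc 1 (n - 1)).image fun k => 2 * k + 1

/-- `A_n = A'_n \ {3, 2 n - 1}`. -/
def A (n : ℕ) : Finset ℕ := A' n \ {3, 2 * n - 1}

/-- Fibonacci subsets of `A'_n`: at least one of each two consecutive elements is present. -/
def IsFibonacci (n : ℕ) (S : Finset ℕ) : Prop :=
  S ⊆ A' n ∧ ∀ k ∈ Finset.Icc 1 (n - 2), 2 * k + 1 ∈ S ∨ 2 * k + 3 ∈ S

/-- `U₁ = {x_i : i ∈ S}`. -/
def U₁ (n : ℕ) (S : Finset ℕ) : Set (MvPolynomial (Vertex n) ℂ) :=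
  {f | ∃ i ∈ S, f = x n i}

/-- The allowed choices of the set `U₂`. -/
def IsU₂ (n : ℕ) (S : Finset ℕ) (U : Set (MvPolynomial (Vertex n) ℂ)) : Prop :=
  (3 ∉ S ∧ 5 ∈ S ∧ U = {x n 1, x n 2}) ∨
  (3 ∈ S ∧ 5 ∈ S ∧ (U = {x n 1} ∨ U = {x n 2})) ∨
  (3 ∈ S ∧ 5 ∉ S ∧ U = {p n 3})

/-- The allowed choices of the set `U₃`. -/
def IsU₃ (n : ℕ) (S : Finset ℕ) (U : Set (MvPolynomial (Vertex n) ℂ)) : Prop :=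
  (2 * n - 1 ∉ S ∧ 2 * n - 3 ∈ S ∧ U = {x n (2 * n), x n (2 * n + 1)}) ∨
  (2 * n - 1 ∈ S ∧ 2 * n - 3 ∈ S ∧ (U = {x n (2 * n)} ∨ U = {x n (2 * n + 1)})) ∨
  (2 * n - 1 ∈ S ∧ 2 * n - 3 ∉ S ∧ U = {p n (2 * n - 1)})

/-- The set `U₄`: each `a ∈ A_n` contributes nothing if `a - 2, a + 2 ∈ S`, and one polynomial
otherwise. -/
def U₄ (n : ℕ) (S : Finset ℕ) : Set (MvPolynomial (Vertex n) ℂ) :=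
  {f | ∃ a ∈ A n,
    (a - 2 ∈ S ∧ a + 2 ∉ S ∧ f = x n (a + 1)) ∨
    (a - 2 ∉ S ∧ a + 2 ∈ S ∧ f = x n (a - 1)) ∨
    (a - 2 ∉ S ∧ a + 2 ∉ S ∧ f = p n a)}

/-- `B` is an `S`-admissible set of polynomials. -/
def IsAdmissible (n : ℕ) (S : Finset ℕ) (B : Set (MvPolynomial (Vertex n) ℂ)) : Prop :=
  ∃ T₂ T₃ : Set (MvPolynomial (Vertex n) ℂ),
    IsU₂ n S T₂ ∧ IsU₃ n S T₃ ∧ B = U₁ n S ∪ T₂ ∪ T₃ ∪ U₄ n S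

/-- The collection `ℐ_n` of the ideals generated by the admissible sets of all Fibonacci
subsets of `A'_n`. -/
def admissibleIdeals (n : ℕ) : Set (Ideal (MvPolynomial (Vertex n) ℂ)) :=
  {I | ∃ S B, IsFibonacci n S ∧ IsAdmissible n S B ∧ I = Ideal.span B}

/-- The collection `𝒲_n` of the varieties `𝒱(I)` with `I ∈ ℐ_n`. -/
def admissibleVarieties (n : ℕ) : Set (Set (Vertex n → ℂ)) :=
  {W | ∃ I ∈ admissibleIdeals n, W = MvPolynomial.zeroLocus ℂ I}

/-- The collection `𝒥_n` of those ideals in `ℐ_n` whose varieties are inclusion-maximal in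
`𝒲_n`. -/
def componentIdeals (n : ℕ) : Set (Ideal (MvPolynomial (Vertex n) ℂ)) :=
  {J | J ∈ admissibleIdeals n ∧
    Maximal (fun W => W ∈ admissibleVarieties n) (MvPolynomial.zeroLocus ℂ J)}

/-- `{a, a + 2, …, a + 2 (m - 1)}` is a maximal run (of length `m ≥ 1`) of consecutive odd
numbers in `S`. -/
def IsMaximalRun (S : Finset ℕ) (a m : ℕ) : Prop :=
  Odd a ∧ 1 ≤ m ∧ (∀ j < m, a + 2 * j ∈ S) ∧ (∀ b, b + 2 = a → b ∉ S) ∧ a + 2 * m ∉ S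

/-- All maximal runs of `S` are singletons or have even length. -/
def HasSingletonOrEvenRuns (S : Finset ℕ) : Prop :=
  ∀ a m, IsMaximalRun S a m → m = 1 ∨ Even m

end LoosePath

/-! Differentiating at an even vertex gives the product of the two odd variables of its edge, at an
end vertex a product of two variables, and at any other odd vertex `a` the binomial `p_a`
(`mem_nullvariety_iff`). For a point of `V₀`, let `S` be the set of inner odd indices at which it
vanishes. The edge products make `S` Fibonacci, and the other equations become those of an
admissible set of `S`. Hence `V₀` is the finite union of the admissible varieties
(`nullvariety_eq_biUnion`).

Each admissible variety is irreducible. A binomial `p_a` survives only if `a` is isolated in `S`, so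
every even variable occurs in at most one surviving binomial, and consecutive binomials share at
most an odd variable. Where the odd variables of such a system do not vanish, its solutions are the
image of a polynomial map; all other solutions are limits of these in the Euclidean topology
(`chainVariety_subset_closure`). Polynomials are continuous, so the image is Zariski dense.

Inclusions become combinatorial: all `p_a` vanish on `V₀`, so one admissible variety contains
another exactly when it kills fewer variables (`admissibleLocus_subset_iff`). A run of odd length at
least 3 can be thinned out, which enlarges the variety (`exists_zeroIndices_ssubset`); a parity
count shows that nothing else can be enlarged (`eq_of_zeroIndices_subset`). -/

namespace LoosePath

/-! ### Chains of binomials: parametrization and its density. -/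

open Filter Topology

/-- The solutions `w : ℕ → ℂ` of the equations `w i = 0` for `i ∈ Z`, and
`w m * w (m + 1) + w (m + 3) * w (m + 4) = 0` for `m ∈ T`. -/
def chainVariety (Z T : Set ℕ) : Set (ℕ → ℂ) :=
  {w | (∀ i ∈ Z, w i = 0) ∧ ∀ m ∈ T, w m * w (m + 1) + w (m + 3) * w (m + 4) = 0}

/-- The conditions on `Z` and `T` under which the equations of `chainVariety Z T` form disjoint
chains of binomials not involving the variables indexed by `Z`. -/
structure IsChainData (Z T : Set ℕ) : Prop where
  odd : ∀ m ∈ T, m % 2 = 1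
  gap : ∀ m ∈ T, m + 2 ∉ T
  disjoint : ∀ m ∈ T, m ∉ Z ∧ m + 1 ∉ Z ∧ m + 3 ∉ Z ∧ m + 4 ∉ Z

open Classical in
/-- A polynomial parametrization of a dense subset of `chainVariety Z T`. -/
noncomputable def chainParam (Z T : Set ℕ) {R : Type*} [CommRing R] (u : ℕ → R) (i : ℕ) : R :=
  if i ∈ Z then 0
  else if 1 ≤ i ∧ i - 1 ∈ T then u i * u (i + 3)
  else if 3 ≤ i ∧ i - 3 ∈ T then -(u (i - 2) * u (i - 3))
  else u i

theorem map_chainParam {Z T : Set ℕ} {R R' : Type*} [CommRing R] [CommRing R'] (f : R →+* R')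
    (u : ℕ → R) (i : ℕ) : f (chainParam Z T u i) = chainParam Z T (fun j => f (u j)) i := by
  unfold chainParam
  split_ifs <;> simp

namespace IsChainData

variable {Z T : Set ℕ} (h : IsChainData Z T) {R : Type*} [CommRing R]
include h

theorem param_zero (u : ℕ → R) {m : ℕ} (hm : m ∈ T) : chainParam Z T u m = u m := by
  have h0 := (h.disjoint m hm).1
  have h1 : ¬(1 ≤ m ∧ m - 1 ∈ T) := fun ⟨a, b⟩ => by
    have := h.odd _ hm; have := h.odd _ b; omega
  have h2 : ¬(3 ≤ m ∧ m - 3 ∈ T) := fun ⟨a, b⟩ => by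
    have := h.odd _ hm; have := h.odd _ b; omega
  simp [chainParam, h0, h1, h2]

theorem param_four (u : ℕ → R) {m : ℕ} (hm : m ∈ T) :
    chainParam Z T u (m + 4) = u (m + 4) := by
  have h0 := (h.disjoint m hm).2.2.2
  have h1 : ¬(1 ≤ m + 4 ∧ m + 4 - 1 ∈ T) := fun ⟨a, b⟩ => by
    have := h.odd _ hm; have := h.odd _ b; omega
  have h2 : ¬(3 ≤ m + 4 ∧ m + 4 - 3 ∈ T) := fun ⟨a, b⟩ => by
    have := h.odd _ hm; have := h.odd _ b; omega
  simp only [chainParam, if_neg h0, if_neg h1, if_neg h2]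

theorem param_one (u : ℕ → R) {m : ℕ} (hm : m ∈ T) :
    chainParam Z T u (m + 1) = u (m + 1) * u (m + 4) := by
  have h0 := (h.disjoint m hm).2.1
  simp [chainParam, h0, hm]

theorem param_three (u : ℕ → R) {m : ℕ} (hm : m ∈ T) :
    chainParam Z T u (m + 3) = -(u (m + 1) * u m) := by
  have h0 := (h.disjoint m hm).2.2.1
  simp [chainParam, h0, hm, h.gap m hm]

theorem param_mem (u : ℕ → ℂ) : chainParam Z T u ∈ chainVariety Z T := by
  refine ⟨fun i hi => by simp [chainParam, hi], fun m hm => ?_⟩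
  rw [h.param_zero u hm, h.param_one u hm, h.param_three u hm, h.param_four u hm]
  ring

/-- With nonzero outer variables the parameter at `m + 1` is recovered as `w (m + 1) / w (m + 4)`,
and the binomial then determines `w (m + 3)`. -/
theorem mem_range_param {w : ℕ → ℂ} (hw : w ∈ chainVariety Z T)
    (hne : ∀ m ∈ T, w m ≠ 0 ∧ w (m + 4) ≠ 0) :
    w ∈ Set.range (chainParam Z T (R := ℂ)) := by
  classical
  let u : ℕ → ℂ := fun i => if 1 ≤ i ∧ i - 1 ∈ T then w i / w (i + 3) else w i
  have u0 : ∀ m ∈ T, u m = w m := fun m hm => by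
    have h1 : ¬(1 ≤ m ∧ m - 1 ∈ T) := fun ⟨a, b⟩ => by
      have := h.odd _ hm; have := h.odd _ b; omega
    simp only [u, if_neg h1]
  have u4 : ∀ m ∈ T, u (m + 4) = w (m + 4) := fun m hm => by
    have h1 : ¬(1 ≤ m + 4 ∧ m + 4 - 1 ∈ T) := fun ⟨a, b⟩ => by
      have := h.odd _ hm; have := h.odd _ b; omega
    simp only [u, if_neg h1]
  have u1 : ∀ m ∈ T, u (m + 1) = w (m + 1) / w (m + 4) := fun m hm => by
    simp [u, hm]
  refine ⟨u, funext fun i => ?_⟩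
  by_cases hZ : i ∈ Z
  · simp [chainParam, hZ, hw.1 i hZ]
  by_cases h1 : 1 ≤ i ∧ i - 1 ∈ T
  · obtain ⟨m, rfl⟩ : ∃ m, i = m + 1 := ⟨i - 1, by omega⟩
    have hm : m ∈ T := by simpa using h1.2
    rw [h.param_one u hm, u1 m hm, u4 m hm, div_mul_cancel₀ _ (hne m hm).2]
  by_cases h3 : 3 ≤ i ∧ i - 3 ∈ T
  · obtain ⟨m, rfl⟩ : ∃ m, i = m + 3 := ⟨i - 3, by omega⟩
    have hm : m ∈ T := by simpa using h3.2
    rw [h.param_three u hm, u1 m hm, u0 m hm]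
    have := hw.2 m hm
    have := (hne m hm).2
    field_simp
    linear_combination -(hw.2 m hm)
  · simp [chainParam, hZ, h1, h3, u]

end IsChainData

theorem mem_closure_of_curve {A : Set (ℕ → ℂ)} (γ : ℂ → ℕ → ℂ) (hγ : ∀ i, Continuous fun t => γ t i)
    (hA : ∀ t, t ≠ 0 → γ t ∈ A) : γ 0 ∈ closure A := by
  have hc : Continuous γ := continuous_pi hγ
  refine mem_closure_of_tendsto (b := 𝓝[≠] (0 : ℂ)) (hc.tendsto 0 |>.mono_left nhdsWithin_le_nhds) ?_
  filter_upwards [self_mem_nhdsWithin] with t ht using hA t ht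

/-- A solution of the recursion `α (i + 4) = r i * α i`. -/
def fourStep (r : ℕ → ℂ) : ℕ → ℂ
  | 0 | 1 | 2 | 3 => 1
  | i + 4 => r i * fourStep r i

theorem fourStep_ne_zero {r : ℕ → ℂ} (hr : ∀ i, r i ≠ 0) (i : ℕ) : fourStep r i ≠ 0 := by
  fun_induction fourStep r i <;> simp_all

namespace IsChainData

variable {Z T : Set ℕ} (h : IsChainData Z T)
include h

/-- If both outer variables of a binomial vanish, its inner variables are unconstrained, since they
occur in no other binomial. Those that are zero can therefore be replaced by a small `t`. -/
theorem mem_closure_generic {w : ℕ → ℂ} (hw : w ∈ chainVariety Z T) :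
    w ∈ closure {v ∈ chainVariety Z T |
      ∀ m ∈ T, v m = 0 → v (m + 4) = 0 → v (m + 1) ≠ 0 ∧ v (m + 3) ≠ 0} := by
  classical
  let P : ℕ → Prop := fun i =>
    w i = 0 ∧ ∃ m ∈ T, w m = 0 ∧ w (m + 4) = 0 ∧ (i = m + 1 ∨ i = m + 3)
  let γ : ℂ → ℕ → ℂ := fun t i => if P i then t else w i
  have h0 : γ 0 = w := funext fun i => by
    simp only [γ]; split_ifs with hi
    exacts [hi.1.symm, rfl]
  rw [← h0]
  refine mem_closure_of_curve γ (fun i => ?_) fun t ht => ?_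
  · simp only [γ]; split_ifs <;> fun_prop
  have γ0 : ∀ i, i % 2 = 1 → γ t i = w i := fun i hi => by
    refine if_neg ?_
    rintro ⟨-, m, hm, -, -, h1 | h1⟩ <;> have := h.odd m hm <;> omega
  have γ1 : ∀ m ∈ T, ∀ j, (j = m + 1 ∨ j = m + 3) → ¬(w m = 0 ∧ w (m + 4) = 0) →
      γ t j = w j := by
    rintro m hm j hj hne
    refine if_neg ?_
    rintro ⟨-, m', hm', h1, h2, h3⟩
    have : m' = m := by
      rcases hj with rfl | rfl <;> rcases h3 with h3 | h3
      · omega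
      · exact absurd hm (by have := h.gap m' hm'; rwa [show m = m' + 2 by omega])
      · exact absurd hm' (by have := h.gap m hm; rwa [show m' = m + 2 by omega])
      · omega
    subst this
    exact hne ⟨h1, h2⟩
  refine ⟨⟨fun i hi => ?_, fun m hm => ?_⟩, fun m hm hm0 hm4 => ?_⟩
  · have : ¬ P i := by
      rintro ⟨-, m, hm, -, -, rfl | rfl⟩ <;> have := h.disjoint m hm <;> tauto
    simp only [γ, if_neg this, hw.1 i hi]
  · have := h.odd m hm
    rw [γ0 m this, γ0 (m + 4) (by omega)]
    by_cases hne : w m = 0 ∧ w (m + 4) = 0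
    · rw [hne.1, hne.2]; ring
    · rw [γ1 m hm _ (Or.inl rfl) hne, γ1 m hm _ (Or.inr rfl) hne]
      exact hw.2 m hm
  · have := h.odd m hm
    rw [γ0 m this] at hm0
    rw [γ0 (m + 4) (by omega)] at hm4
    constructor <;> simp only [γ] <;> split_ifs with hP
    · exact ht
    · exact fun h0 => hP ⟨h0, m, hm, hm0, hm4, Or.inl rfl⟩
    · exact ht
    · exact fun h0 => hP ⟨h0, m, hm, hm0, hm4, Or.inr rfl⟩

/-- Each vanishing outer variable is moved to `t * α i`. If both outer variables of a binomial
vanish, the binomial prescribes the ratio `α (m + 4) / α m`, which is finite and nonzero by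
genericity. If only one vanishes, the inner variable next to the other one is zero and can be
corrected to first order in `t` without affecting any other binomial. -/
theorem mem_closure_range_param_of_generic {w : ℕ → ℂ} (hw : w ∈ chainVariety Z T)
    (hg : ∀ m ∈ T, w m = 0 → w (m + 4) = 0 → w (m + 1) ≠ 0 ∧ w (m + 3) ≠ 0) :
    w ∈ closure (Set.range (chainParam Z T (R := ℂ))) := by
  classical
  let r : ℕ → ℂ := fun m =>
    if m ∈ T ∧ w m = 0 ∧ w (m + 4) = 0 then -(w (m + 1) / w (m + 3)) else 1
  let α := fourStep r
  have hα : ∀ i, α i ≠ 0 := fourStep_ne_zero fun m => by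
    simp only [r]; split_ifs with hm
    · have := hg m hm.1 hm.2.1 hm.2.2
      simpa using this
    · exact one_ne_zero
  have hαT : ∀ m ∈ T, w m = 0 → w (m + 4) = 0 →
      α m * w (m + 1) + w (m + 3) * α (m + 4) = 0 := fun m hm h0 h4 => by
    have hr : r m = -(w (m + 1) / w (m + 3)) := if_pos ⟨hm, h0, h4⟩
    have : α (m + 4) = r m * α m := by simp only [α, fourStep]
    have h3 := (hg m hm h0 h4).2
    rw [this, hr]
    field_simp
    ring
  -- `Y` marks the outer variables to be moved; `P₁` and `P₃` mark the inner variables, at `m + 1`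
  -- and `m + 3`, that compensate when exactly one outer variable is moved.
  let Y : ℕ → Prop := fun i => (i ∈ T ∨ 4 ≤ i ∧ i - 4 ∈ T) ∧ w i = 0
  let P₁ : ℕ → Prop := fun i => (1 ≤ i ∧ i - 1 ∈ T) ∧ w (i - 1) ≠ 0 ∧ w (i + 3) = 0
  let P₃ : ℕ → Prop := fun i => (3 ≤ i ∧ i - 3 ∈ T) ∧ w (i - 3) = 0 ∧ w (i + 1) ≠ 0
  let γ : ℂ → ℕ → ℂ := fun t i =>
    if Y i then t * α i
    else if P₁ i then -(w (i + 2) * (t * α (i + 3))) / w (i - 1)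
    else if P₃ i then -(w (i - 2) * (t * α (i - 3))) / w (i + 1)
    else w i
  have γ0 : γ 0 = w := funext fun i => by
    simp only [γ]
    split_ifs with h1 h2 h3
    · simp [h1.2]
    · obtain ⟨⟨h1', h2'⟩, h3, h4⟩ := h2
      obtain ⟨m, rfl⟩ : ∃ m, i = m + 1 := ⟨i - 1, by omega⟩
      simp only [Nat.add_sub_cancel] at *
      have := hw.2 m h2'
      rw [h4] at this
      have : w (m + 1) = 0 := by simpa [h3] using this
      simp [this]
    · obtain ⟨⟨h1', h2'⟩, h3, h4⟩ := h3
      obtain ⟨m, rfl⟩ : ∃ m, i = m + 3 := ⟨i - 3, by omega⟩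
      simp only [Nat.add_sub_cancel] at *
      have := hw.2 m h2'
      rw [h3] at this
      have : w (m + 3) = 0 := by simpa [h4] using this
      simp [this]
    · rfl
  rw [← γ0]
  refine mem_closure_of_curve γ (fun i => ?_) fun t ht => ?_
  · simp only [γ]; split_ifs <;> fun_prop
  have notP : ∀ i, i % 2 = 1 → ¬ P₁ i ∧ ¬ P₃ i := fun i hi => by
    constructor
    · rintro ⟨⟨a, b⟩, -⟩; have := h.odd _ b; omega
    · rintro ⟨⟨a, b⟩, -⟩; have := h.odd _ b; omega
  have notY : ∀ i, i % 2 = 0 → ¬ Y i := fun i hi => by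
    rintro ⟨a | ⟨a, b⟩, -⟩
    · have := h.odd _ a; omega
    · have := h.odd _ b; omega
  have e0 : ∀ m ∈ T, γ t m = if w m = 0 then t * α m else w m := fun m hm => by
    have hY : Y m ↔ w m = 0 := by simp [Y, hm]
    have hp := notP m (h.odd m hm)
    simp only [γ, if_neg hp.1, if_neg hp.2, hY]
  have e4 : ∀ m ∈ T, γ t (m + 4) = if w (m + 4) = 0 then t * α (m + 4) else w (m + 4) :=
    fun m hm => by
    have hY : Y (m + 4) ↔ w (m + 4) = 0 := by simp [Y, hm]
    have hp := notP (m + 4) (by have := h.odd m hm; omega)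
    simp only [γ, if_neg hp.1, if_neg hp.2, hY]
  have e1 : ∀ m ∈ T, γ t (m + 1) = if w m ≠ 0 ∧ w (m + 4) = 0 then
      -(w (m + 3) * (t * α (m + 4))) / w m else w (m + 1) := fun m hm => by
    have hP : P₁ (m + 1) ↔ w m ≠ 0 ∧ w (m + 4) = 0 := by simp [P₁, hm]
    have hP3 : ¬ P₃ (m + 1) := by
      rintro ⟨⟨a, b⟩, -⟩
      exact h.gap _ b (by rwa [show m + 1 - 3 + 2 = m by omega])
    have hY := notY (m + 1) (by have := h.odd m hm; omega)
    simp only [γ, if_neg hY, if_neg hP3, hP, Nat.add_sub_cancel, add_assoc, Nat.reduceAdd]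
  have e3 : ∀ m ∈ T, γ t (m + 3) = if w m = 0 ∧ w (m + 4) ≠ 0 then
      -(w (m + 1) * (t * α m)) / w (m + 4) else w (m + 3) := fun m hm => by
    have hP : P₃ (m + 3) ↔ w m = 0 ∧ w (m + 4) ≠ 0 := by simp [P₃, hm]
    have hP1 : ¬ P₁ (m + 3) := by
      rintro ⟨⟨a, b⟩, -⟩
      exact h.gap m hm b
    have hY := notY (m + 3) (by have := h.odd m hm; omega)
    simp only [γ, if_neg hY, if_neg hP1, hP, Nat.add_sub_cancel, add_assoc, Nat.reduceAdd,
      show m + 3 - 2 = m + 1 by omega]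
  refine h.mem_range_param ⟨fun i hi => ?_, fun m hm => ?_⟩ fun m hm => ?_
  · have nY : ¬ Y i := by
      rintro ⟨a | ⟨a, b⟩, -⟩
      · exact (h.disjoint i a).1 hi
      · exact (h.disjoint _ b).2.2.2 (by rwa [Nat.sub_add_cancel a])
    have n1 : ¬ P₁ i := by
      rintro ⟨⟨a, b⟩, -⟩
      exact (h.disjoint _ b).2.1 (by rwa [Nat.sub_add_cancel a])
    have n3 : ¬ P₃ i := by
      rintro ⟨⟨a, b⟩, -⟩
      exact (h.disjoint _ b).2.2.1 (by rwa [Nat.sub_add_cancel a])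
    simp only [γ, if_neg nY, if_neg n1, if_neg n3, hw.1 i hi]
  · have hwm := hw.2 m hm
    rw [e0 m hm, e1 m hm, e3 m hm, e4 m hm]
    by_cases h0 : w m = 0 <;> by_cases h4 : w (m + 4) = 0
    · simp only [h0, h4, if_true, ne_eq, not_true, false_and, and_false, if_false]
      linear_combination t * hαT m hm h0 h4
    · simp only [h0, h4, if_true, ne_eq, not_true, not_false_eq_true, and_self, if_false]
      field_simp
      ring
    · simp only [h0, h4, if_true, ne_eq, not_true, not_false_eq_true, and_self, if_false]
      field_simp
      ring
    · simpa [h0, h4] using hwm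
  · rw [e0 m hm, e4 m hm]
    constructor <;> split_ifs with h0
    exacts [mul_ne_zero ht (hα _), h0, mul_ne_zero ht (hα _), h0]

theorem chainVariety_subset_closure :
    chainVariety Z T ⊆ closure (Set.range (chainParam Z T (R := ℂ))) := fun _ hw =>
  closure_minimal (fun _ hv => h.mem_closure_range_param_of_generic hv.1 hv.2) isClosed_closure
    (h.mem_closure_generic hw)

end IsChainData

end LoosePath

namespace LoosePath

/-! ### Irreducible varieties and Zariski density. -/

open MvPolynomial

section Varieties

variable {σ : Type}

theorem IsAffineVariety.inter {V W : Set (σ → ℂ)} (hV : IsAffineVariety V)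
    (hW : IsAffineVariety W) : IsAffineVariety (V ∩ W) := by
  obtain ⟨I, rfl⟩ := hV
  obtain ⟨J, rfl⟩ := hW
  refine ⟨Ideal.span (I ∪ J), ?_⟩
  rw [zeroLocus_span]
  ext v
  exact ⟨fun hv f hf => hf.elim (hv.1 f) (hv.2 f),
    fun hv => ⟨fun f hf => hv f (Or.inl hf), fun f hf => hv f (Or.inr hf)⟩⟩

theorem isAffineVariety_empty : IsAffineVariety (∅ : Set (σ → ℂ)) :=
  ⟨⊤, zeroLocus_top.symm⟩

theorem IsAffineVariety.union {V W : Set (σ → ℂ)} (hV : IsAffineVariety V)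
    (hW : IsAffineVariety W) : IsAffineVariety (V ∪ W) := by
  obtain ⟨I, rfl⟩ := hV
  obtain ⟨J, rfl⟩ := hW
  refine ⟨I * J, Set.Subset.antisymm ?_ fun v hv => ?_⟩
  · rintro v (hv | hv)
    · exact zeroLocus_anti_mono Ideal.mul_le_left hv
    · exact zeroLocus_anti_mono Ideal.mul_le_right hv
  · by_contra hc
    rw [Set.mem_union, not_or] at hc
    simp only [mem_zeroLocus_iff, not_forall] at hc
    obtain ⟨⟨f, hf, hf0⟩, g, hg, hg0⟩ := hc
    have := hv (f * g) (Ideal.mul_mem_mul hf hg)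
    rw [map_mul] at this
    exact (mul_ne_zero hf0 hg0) this

theorem isAffineVariety_biUnion {ι : Type*} {s : Set ι} (hs : s.Finite) {V : ι → Set (σ → ℂ)}
    (hV : ∀ i ∈ s, IsAffineVariety (V i)) : IsAffineVariety (⋃ i ∈ s, V i) := by
  induction s, hs using Set.Finite.induction_on with
  | empty => simpa using isAffineVariety_empty
  | @insert a s _ _ ih =>
    rw [Set.biUnion_insert]
    exact (hV a (Set.mem_insert a s)).union (ih fun i hi => hV i (Set.mem_insert_of_mem a hi))

/-- An irreducible variety covered by finitely many varieties is contained in one of them. -/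
theorem IsIrreducibleVariety.exists_subset {W : Set (σ → ℂ)} (hW : IsIrreducibleVariety W)
    {s : Set (Set (σ → ℂ))} (hs : s.Finite) (hV : ∀ V ∈ s, IsAffineVariety V)
    (hc : W ⊆ ⋃ V ∈ s, V) : ∃ V ∈ s, W ⊆ V := by
  induction s, hs using Set.Finite.induction_on with
  | empty =>
    obtain ⟨w, hw⟩ := hW.2.1
    simpa using hc hw
  | @insert a s _ hfin ih =>
    rw [Set.biUnion_insert] at hc
    have hU : IsAffineVariety (⋃ V ∈ s, V) :=
      isAffineVariety_biUnion hfin fun V hVs => hV V (Set.mem_insert_of_mem a hVs)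
    have h1 : W = W ∩ a ∪ W ∩ ⋃ V ∈ s, V := by
      rw [← Set.inter_union_distrib_left, Set.inter_eq_left.2 hc]
    rcases hW.2.2 _ _ (hW.1.inter (hV a (Set.mem_insert a s))) (hW.1.inter hU) h1 with h | h
    · exact ⟨a, Set.mem_insert a s, Set.inter_eq_left.1 h.symm⟩
    · obtain ⟨V, hVs, hWV⟩ := ih (fun V hVs => hV V (Set.mem_insert_of_mem a hVs))
        (Set.inter_eq_left.1 h.symm)
      exact ⟨V, Set.mem_insert_of_mem a hVs, hWV⟩

/-- A variety in which the image of a polynomial map from an affine space is Zariski dense is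
irreducible. -/
theorem isIrreducibleVariety_of_parametrization {τ : Type*} {V : Set (σ → ℂ)}
    (hV : IsAffineVariety V) (φ : σ → MvPolynomial τ ℂ)
    (hφ : ∀ u : τ → ℂ, (fun i => eval u (φ i)) ∈ V)
    (hd : ∀ f : MvPolynomial σ ℂ, (∀ u : τ → ℂ, eval (fun i => eval u (φ i)) f = 0) →
      ∀ v ∈ V, eval v f = 0) : IsIrreducibleVariety V := by
  refine ⟨hV, ⟨_, hφ 0⟩, ?_⟩
  rintro W₁ W₂ ⟨I, hI⟩ ⟨J, hJ⟩ hW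
  by_contra hc
  -- A proper subvariety has an equation with nonzero pullback along `φ`. Two such equations, one
  -- for each piece, would have pullbacks with zero product in a polynomial ring, which is a domain.
  have hle : ∀ (K : Ideal (MvPolynomial σ ℂ)) (W : Set (σ → ℂ)), W = zeroLocus ℂ K → W ⊆ V →
      V ≠ W → ∃ f ∈ K, bind₁ φ f ≠ 0 := by
    intro K W hK hWV hne
    by_contra hcon
    push Not at hcon
    refine hne (Set.Subset.antisymm (fun v hv => ?_) hWV)
    rw [hK]
    intro f hf
    rw [aeval_eq_eval]
    refine hd f (fun u => ?_) v hv
    have := congrArg (eval u) (hcon f hf)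
    rw [map_zero, eval, eval₂Hom_bind₁] at this
    exact this
  rw [not_or] at hc
  obtain ⟨f, hf, hf0⟩ := hle I W₁ hI (hW ▸ Set.subset_union_left) hc.1
  obtain ⟨g, hg, hg0⟩ := hle J W₂ hJ (hW ▸ Set.subset_union_right) hc.2
  refine mul_ne_zero hf0 hg0 ?_
  rw [← map_mul]
  refine MvPolynomial.funext fun u => ?_
  rw [map_zero, eval, eval₂Hom_bind₁]
  have hu := hφ u
  rw [hW, hI, hJ] at hu
  change eval (fun i => eval u (φ i)) (f * g) = 0
  rw [map_mul]
  rcases hu with hu | hu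
  · have := hu f hf
    rw [aeval_eq_eval] at this
    rw [show eval (fun i => eval u (φ i)) f = 0 from this, zero_mul]
  · have := hu g hg
    rw [aeval_eq_eval] at this
    rw [show eval (fun i => eval u (φ i)) g = 0 from this, mul_zero]

end Varieties

/-- The coordinates of `v`, extended by zero. -/
noncomputable def coord {n : ℕ} (v : Vertex n → ℂ) (i : ℕ) : ℂ := eval v (x n i)

theorem coord_restrict {n : ℕ} (w : ℕ → ℂ) {i : ℕ} (h1 : 1 ≤ i) (h2 : i ≤ 2 * n + 1) :
    coord (fun v : Vertex n => w v.1) i = w i := by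
  have : i ∈ Finset.Icc 1 (2 * n + 1) := Finset.mem_Icc.2 ⟨h1, h2⟩
  simp only [coord, x, dif_pos this, eval_X]

theorem coord_restrict_eq_zero {n : ℕ} (w : ℕ → ℂ) {i : ℕ} (h : w i = 0) :
    coord (fun v : Vertex n => w v.1) i = 0 := by
  by_cases hi : i ∈ Finset.Icc 1 (2 * n + 1) <;> simp [coord, x, hi, h]

theorem restrict_coord {n : ℕ} (v : Vertex n → ℂ) : (fun i : Vertex n => coord v i.1) = v :=
  funext fun i => by simp only [coord, x, dif_pos i.2, eval_X]

/-- The points of `ℂ ^ (2 n + 1)` whose coordinates satisfy the equations of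
`chainVariety Z T`. -/
def chainLocus (n : ℕ) (Z T : Set ℕ) : Set (Vertex n → ℂ) :=
  {v | coord v ∈ chainVariety Z T}

theorem isAffineVariety_chainLocus (n : ℕ) (Z T : Set ℕ) :
    IsAffineVariety (chainLocus n Z T) := by
  refine ⟨Ideal.span ({f | ∃ i ∈ Z, f = x n i} ∪
    {f | ∃ m ∈ T, f = x n m * x n (m + 1) + x n (m + 3) * x n (m + 4)}), ?_⟩
  rw [zeroLocus_span]
  ext v
  simp only [aeval_eq_eval]
  constructor
  · rintro hv _ (⟨i, hi, rfl⟩ | ⟨m, hm, rfl⟩)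
    · exact hv.1 i hi
    · have := hv.2 m hm
      simpa [coord] using this
  · intro hv
    refine ⟨fun i hi => hv _ (Or.inl ⟨i, hi, rfl⟩), fun m hm => ?_⟩
    have := hv _ (Or.inr ⟨m, hm, rfl⟩)
    simpa [coord] using this

/-- The bounds on `T` matter: truncating `w` to the vertices must not cut a term out of a binomial.
-/
theorem restrict_mem_chainLocus {n : ℕ} {Z T : Set ℕ} (hT : ∀ m ∈ T, 1 ≤ m ∧ m + 4 ≤ 2 * n + 1)
    {w : ℕ → ℂ} (hw : w ∈ chainVariety Z T) : (fun v : Vertex n => w v.1) ∈ chainLocus n Z T := by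
  refine ⟨fun i hi => coord_restrict_eq_zero w (hw.1 i hi), fun m hm => ?_⟩
  have := hT m hm
  rw [coord_restrict w (by omega) (by omega), coord_restrict w (by omega) (by omega),
    coord_restrict w (by omega) (by omega), coord_restrict w (by omega) (by omega)]
  exact hw.2 m hm

/-- The zero set of a polynomial is closed in the product topology, so a polynomial vanishing on the
range of `chainParam` vanishes on its closure, which contains the whole chain variety. -/
theorem IsChainData.isIrreducibleVariety {n : ℕ} {Z T : Set ℕ} (h : IsChainData Z T)
    (hT : ∀ m ∈ T, 1 ≤ m ∧ m + 4 ≤ 2 * n + 1) : IsIrreducibleVariety (chainLocus n Z T) := by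
  have hev : ∀ u : ℕ → ℂ, (fun i : Vertex n =>
      eval u (chainParam Z T (X : ℕ → MvPolynomial ℕ ℂ) i.1)) =
      fun i : Vertex n => chainParam Z T u i.1 := fun u => funext fun i => by
    rw [map_chainParam (eval u)]
    simp
  refine isIrreducibleVariety_of_parametrization (isAffineVariety_chainLocus n Z T)
    (fun i => chainParam Z T (X : ℕ → MvPolynomial ℕ ℂ) i.1) (fun u => ?_) fun f hf v hv => ?_
  · rw [hev]
    exact restrict_mem_chainLocus hT (h.param_mem u)
  · have hcl := h.chainVariety_subset_closure hv
    have hcont : Continuous fun w : ℕ → ℂ => eval (fun i : Vertex n => w i.1) f :=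
      (continuous_eval f).comp (by fun_prop)
    have hclosed : IsClosed {w : ℕ → ℂ | eval (fun i : Vertex n => w i.1) f = 0} :=
      isClosed_eq hcont continuous_const
    have hsub : Set.range (chainParam Z T (R := ℂ)) ⊆
        {w : ℕ → ℂ | eval (fun i : Vertex n => w i.1) f = 0} := by
      rintro _ ⟨u, rfl⟩
      have := hf u
      rw [hev] at this
      exact this
    have : eval (fun i : Vertex n => coord v i.1) f = 0 := closure_minimal hsub hclosed hcl
    rwa [restrict_coord] at this

/-- The locus has a point whose coordinates outside `Z` do not vanish. -/
theorem IsChainData.subset_of_chainLocus_subset {n : ℕ} {Z T Z' T' : Set ℕ} (h : IsChainData Z T)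
    (hT : ∀ m ∈ T, 1 ≤ m ∧ m + 4 ≤ 2 * n + 1) (hZ' : ∀ i ∈ Z', 1 ≤ i ∧ i ≤ 2 * n + 1)
    (hsub : chainLocus n Z T ⊆ chainLocus n Z' T') : Z' ⊆ Z := by
  intro i hi
  by_contra hiZ
  -- With all parameters equal to 1, every coordinate outside `Z` is 1 or -1.
  have := (hsub (restrict_mem_chainLocus hT (h.param_mem fun _ => 1))).1 i hi
  rw [coord_restrict _ (hZ' i hi).1 (hZ' i hi).2] at this
  unfold chainParam at this
  split_ifs at this <;> simp_all

end LoosePath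

namespace LoosePath

/-! ### The equations of the nullvariety. -/

open MvPolynomial

theorem pderiv_x (n : ℕ) (v : Vertex n) (i : ℕ) :
    pderiv v (x n i) = if v.1 = i then 1 else 0 := by
  unfold x
  split_ifs with h h' h'
  · subst h'; simp
  · exact pderiv_X_of_ne fun e => h' (by rw [← e])
  · exact absurd (h' ▸ v.2) h
  · simp

theorem sum_range_eq_triple {V : Type} [Fintype V] [DecidableEq V] {a b c : V} (hab : a ≠ b)
    (hac : a ≠ c) (hbc : b ≠ c) {R : Type*} [CommRing R] (X : V → R) :
    (∑ i : Fin 3 → V, open Classical in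
      if Set.range i = {a, b, c} then ∏ j, X (i j) else 0) = 6 * (X a * X b * X c) := by
  classical
  have hba := hab.symm
  have hca := hac.symm
  have hcb := hbc.symm
  rw [← Finset.sum_filter]
  have hs : (Finset.univ.filter fun i : Fin 3 → V => Set.range i = {a, b, c}) =
      {![a, b, c], ![a, c, b], ![b, a, c], ![b, c, a], ![c, a, b], ![c, b, a]} := by
    ext i
    simp only [Finset.mem_filter, Finset.mem_univ, true_and, Finset.mem_insert,
      Finset.mem_singleton]
    constructor
    · intro h
      have hm : ∀ j, i j = a ∨ i j = b ∨ i j = c := fun j => by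
        have : i j ∈ Set.range i := ⟨j, rfl⟩
        rw [h] at this
        simpa using this
      have hr : ∀ d, d = a ∨ d = b ∨ d = c → i 0 = d ∨ i 1 = d ∨ i 2 = d := fun d hd => by
        have : d ∈ Set.range i := by rw [h]; simpa using hd
        obtain ⟨j, rfl⟩ := this
        fin_cases j <;> simp
      have ha := hr a (by simp)
      have hb := hr b (by simp)
      have hc := hr c (by simp)
      have he : i = ![i 0, i 1, i 2] := by ext j; fin_cases j <;> rfl
      rw [he]
      rcases hm 0 with h0 | h0 | h0 <;> rcases hm 1 with h1 | h1 | h1 <;>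
        rcases hm 2 with h2 | h2 | h2 <;> rw [h0, h1, h2] at ha hb hc ⊢ <;>
        simp [hab, hac, hbc, hba, hca, hcb] at ha hb hc ⊢
    · rintro (rfl | rfl | rfl | rfl | rfl | rfl) <;>
      · ext d
        simp [eq_comm]
        try tauto
  rw [hs]
  repeat rw [Finset.sum_insert (by simp [_root_.funext_iff, Fin.forall_fin_succ, *])]
  rw [Finset.sum_singleton]
  simp only [Fin.prod_univ_three, Matrix.cons_val_zero, Matrix.cons_val_one, Matrix.cons_val]
  ring

/-- Each edge is met by its six orderings with weight 1/2, whence the coefficient 3. An edge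
determines its index `j` through its middle vertex `2 * j`, so no edge is counted twice. -/
theorem form_adjacencyHypermatrix (n : ℕ) :
    Hypermatrix.form ((loosePath n).adjacencyHypermatrix 3) =
      ∑ j ∈ Finset.Icc 1 n, 3 * (x n (2 * j - 1) * x n (2 * j) * x n (2 * j + 1)) := by
  classical
  let E : ℕ → Set (Vertex n) := fun j => {v | 2 * (j - 1) + 1 ≤ v.1 ∧ v.1 ≤ 2 * j + 1}
  have hE : ∀ j ∈ Finset.Icc 1 n, ∀ j' ∈ Finset.Icc 1 n, E j = E j' → j = j' := by
    intro j hj j' hj' he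
    rw [Finset.mem_Icc] at hj hj'
    have h1 : (⟨2 * j, by rw [Finset.mem_Icc]; omega⟩ : Vertex n) ∈ E j' := by
      rw [← he]; simp only [E, Set.mem_ofPred_eq]; omega
    simp only [E, Set.mem_ofPred_eq] at h1
    omega
  have hM : ∀ i : Fin 3 → Vertex n, (loosePath n).adjacencyHypermatrix 3 i =
      ∑ j ∈ Finset.Icc 1 n, if Set.range i = E j then (1 / 2 : ℂ) else 0 := by
    intro i
    unfold Hypergraph.adjacencyHypermatrix
    split_ifs with h
    · obtain ⟨j, hj, hje⟩ := h
      rw [Finset.sum_eq_single_of_mem j hj]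
      · rw [if_pos hje]; norm_num
      · intro j' hj' hne
        exact if_neg fun h' => hne (hE _ hj' _ hj (h'.symm.trans hje))
    · refine (Finset.sum_eq_zero fun j hj => if_neg fun h' => h ⟨j, hj, h'⟩).symm
  unfold Hypermatrix.form
  simp_rw [hM, map_sum, Finset.sum_mul]
  rw [Finset.sum_comm]
  refine Finset.sum_congr rfl fun j hj => ?_
  rw [Finset.mem_Icc] at hj
  have ha : 2 * j - 1 ∈ Finset.Icc 1 (2 * n + 1) := by rw [Finset.mem_Icc]; omega
  have hb : 2 * j ∈ Finset.Icc 1 (2 * n + 1) := by rw [Finset.mem_Icc]; omega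
  have hc : 2 * j + 1 ∈ Finset.Icc 1 (2 * n + 1) := by rw [Finset.mem_Icc]; omega
  have hEj : E j = {⟨2 * j - 1, ha⟩, ⟨2 * j, hb⟩, ⟨2 * j + 1, hc⟩} := by
    ext v
    simp only [E, Set.mem_ofPred_eq, Set.mem_insert_iff, Set.mem_singleton_iff, Subtype.ext_iff]
    omega
  have key := sum_range_eq_triple (a := (⟨2 * j - 1, ha⟩ : Vertex n)) (b := ⟨2 * j, hb⟩)
    (c := ⟨2 * j + 1, hc⟩) (by simp only [ne_eq, Subtype.mk.injEq]; omega)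
    (by simp only [ne_eq, Subtype.mk.injEq]; omega)
    (by simp only [ne_eq, Subtype.mk.injEq]; omega) (X : Vertex n → MvPolynomial (Vertex n) ℂ)
  have h3 : (3 : MvPolynomial (Vertex n) ℂ) = C (1 / 2) * 6 := by
    rw [show (6 : MvPolynomial (Vertex n) ℂ) = C 6 from rfl, ← C_mul]
    norm_num
    rfl
  simp only [x, dif_pos ha, dif_pos hb, dif_pos hc]
  rw [h3, mul_assoc, ← key, Finset.mul_sum]
  refine Finset.sum_congr rfl fun i _ => ?_
  rw [hEj]
  split_ifs <;> simp

theorem mem_nullvariety_iff_sum {n : ℕ} {v : Vertex n → ℂ} :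
    v ∈ nullvariety n ↔ ∀ i, 1 ≤ i → i ≤ 2 * n + 1 →
      ∑ j ∈ Finset.Icc 1 n,
        ((if i = 2 * j - 1 then coord v (2 * j) * coord v (2 * j + 1) else 0) +
        (if i = 2 * j then coord v (2 * j - 1) * coord v (2 * j + 1) else 0) +
        (if i = 2 * j + 1 then coord v (2 * j - 1) * coord v (2 * j) else 0)) = 0 := by
  have key : ∀ i : Vertex n, eval v (pderiv i (Hypermatrix.form
      ((loosePath n).adjacencyHypermatrix 3 - (0 : ℂ) • Hypermatrix.identity 3 (Vertex n)))) =
      3 * ∑ j ∈ Finset.Icc 1 n,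
        ((if i.1 = 2 * j - 1 then coord v (2 * j) * coord v (2 * j + 1) else 0) +
        (if i.1 = 2 * j then coord v (2 * j - 1) * coord v (2 * j + 1) else 0) +
        (if i.1 = 2 * j + 1 then coord v (2 * j - 1) * coord v (2 * j) else 0)) := fun i => by
    rw [zero_smul, sub_zero, form_adjacencyHypermatrix, map_sum, map_sum, Finset.mul_sum]
    refine Finset.sum_congr rfl fun j _ => ?_
    rw [show (3 : MvPolynomial (Vertex n) ℂ) = C 3 from rfl, pderiv_C_mul, pderiv_mul, pderiv_mul,
      pderiv_x, pderiv_x, pderiv_x]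
    simp only [coord, map_mul, map_add, eval_C]
    split_ifs <;> simp <;> ring
  constructor
  · intro h i h1 h2
    have := h ⟨i, Finset.mem_Icc.2 ⟨h1, h2⟩⟩
    rw [key] at this
    simpa using this
  · intro h i
    have hi := Finset.mem_Icc.1 i.2
    rw [key, h i.1 hi.1 hi.2, mul_zero]

/-- Even vertices and the two end vertices lie in one edge and give monomials; every other odd
vertex lies in two edges and gives a binomial. -/
theorem mem_nullvariety_iff {n : ℕ} (hn : 1 ≤ n) {v : Vertex n → ℂ} :
    v ∈ nullvariety n ↔
      (∀ j, 1 ≤ j → j ≤ n → coord v (2 * j - 1) * coord v (2 * j + 1) = 0) ∧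
      coord v 2 * coord v 3 = 0 ∧ coord v (2 * n - 1) * coord v (2 * n) = 0 ∧
      ∀ j, 1 ≤ j → j + 1 ≤ n → coord v (2 * j - 1) * coord v (2 * j) +
        coord v (2 * j + 2) * coord v (2 * j + 3) = 0 := by
  rw [mem_nullvariety_iff_sum]
  simp only [Finset.sum_add_distrib]
  have even : ∀ j, 1 ≤ j → j ≤ n →
      (∑ j' ∈ Finset.Icc 1 n, if 2 * j = 2 * j' - 1 then
          coord v (2 * j') * coord v (2 * j' + 1) else 0) +
        (∑ j' ∈ Finset.Icc 1 n, if 2 * j = 2 * j' then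
          coord v (2 * j' - 1) * coord v (2 * j' + 1) else 0) +
        (∑ j' ∈ Finset.Icc 1 n, if 2 * j = 2 * j' + 1 then
          coord v (2 * j' - 1) * coord v (2 * j') else 0) =
      coord v (2 * j - 1) * coord v (2 * j + 1) := by
    intro j h1 h2
    rw [Finset.sum_eq_zero, Finset.sum_eq_single_of_mem j (Finset.mem_Icc.2 ⟨h1, h2⟩),
      Finset.sum_eq_zero]
    · simp
    · intro j' hj'; exact if_neg (by omega)
    · intro j' hj' hne; exact if_neg (by omega)
    · intro j' hj'; rw [Finset.mem_Icc] at hj'; exact if_neg (by omega)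
  have mid : ∀ i, ∑ j' ∈ Finset.Icc 1 n, (if 2 * i + 1 = 2 * j' then
      coord v (2 * j' - 1) * coord v (2 * j' + 1) else 0) = 0 := fun i =>
    Finset.sum_eq_zero fun j' _ => if_neg (by omega)
  have right : ∀ i, i + 1 ≤ n → ∑ j' ∈ Finset.Icc 1 n, (if 2 * i + 1 = 2 * j' - 1 then
      coord v (2 * j') * coord v (2 * j' + 1) else 0) =
      coord v (2 * i + 2) * coord v (2 * i + 3) := fun i hi => by
    rw [Finset.sum_eq_single_of_mem (i + 1) (Finset.mem_Icc.2 ⟨by omega, hi⟩)]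
    · exact if_pos (by omega)
    · intro j' hj' hne; exact if_neg (by omega)
  have left : ∀ i, 1 ≤ i → i ≤ n → ∑ j' ∈ Finset.Icc 1 n, (if 2 * i + 1 = 2 * j' + 1 then
      coord v (2 * j' - 1) * coord v (2 * j') else 0) =
      coord v (2 * i - 1) * coord v (2 * i) := fun i h1 hi => by
    rw [Finset.sum_eq_single_of_mem i (Finset.mem_Icc.2 ⟨h1, hi⟩)]
    · exact if_pos rfl
    · intro j' hj' hne; exact if_neg (by omega)
  have left0 : ∑ j' ∈ Finset.Icc 1 n, (if 2 * 0 + 1 = 2 * j' + 1 then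
      coord v (2 * j' - 1) * coord v (2 * j') else 0) = 0 :=
    Finset.sum_eq_zero fun j' hj' => by
      rw [Finset.mem_Icc] at hj'; exact if_neg (by omega)
  have rightn : ∑ j' ∈ Finset.Icc 1 n, (if 2 * n + 1 = 2 * j' - 1 then
      coord v (2 * j') * coord v (2 * j' + 1) else 0) = 0 :=
    Finset.sum_eq_zero fun j' hj' => by
      rw [Finset.mem_Icc] at hj'; exact if_neg (by omega)
  constructor
  · intro h
    refine ⟨fun j h1 h2 => ?_, ?_, ?_, fun j h1 h2 => ?_⟩
    · rw [← even j h1 h2]; exact h (2 * j) (by omega) (by omega)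
    · have := h (2 * 0 + 1) (by omega) (by omega)
      rw [mid, left0, right 0 (by omega)] at this
      simpa using this
    · have := h (2 * n + 1) (by omega) (by omega)
      rw [mid, left n hn le_rfl, rightn] at this
      simpa using this
    · have := h (2 * j + 1) (by omega) (by omega)
      rw [mid, left j h1 (by omega), right j h2] at this
      linear_combination this
  · rintro ⟨h1, h2, h3, h4⟩ i hi hi'
    obtain ⟨j, rfl | rfl⟩ : ∃ j, i = 2 * j ∨ i = 2 * j + 1 := ⟨i / 2, by omega⟩
    · rw [even j (by omega) (by omega)]; exact h1 j (by omega) (by omega)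
    · rw [mid]
      rcases Nat.eq_zero_or_pos j with rfl | hj
      · rw [left0, right 0 (by omega)]; simpa using h2
      rcases eq_or_lt_of_le (show j ≤ n by omega) with rfl | hjn
      · rw [rightn, left j hn le_rfl]; simpa using h3
      · rw [left j hj (by omega), right j hjn]
        linear_combination h4 j hj hjn

end LoosePath

namespace LoosePath

/-! ### Admissible varieties as chain loci. -/

open MvPolynomial

theorem mem_A' {n i : ℕ} : i ∈ A' n ↔ 3 ≤ i ∧ i + 1 ≤ 2 * n ∧ i % 2 = 1 := by
  simp only [A', Finset.mem_image, Finset.mem_Icc]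
  constructor
  · rintro ⟨k, hk, rfl⟩; omega
  · rintro ⟨h1, h2, h3⟩; exact ⟨i / 2, by omega, by omega⟩

theorem mem_A {n i : ℕ} : i ∈ A n ↔ 5 ≤ i ∧ i + 3 ≤ 2 * n ∧ i % 2 = 1 := by
  simp only [A, Finset.mem_sdiff, mem_A', Finset.mem_insert, Finset.mem_singleton]
  omega

theorem isFibonacci_iff {n : ℕ} {S : Finset ℕ} : IsFibonacci n S ↔
    (∀ i ∈ S, 3 ≤ i ∧ i + 1 ≤ 2 * n ∧ i % 2 = 1) ∧
      ∀ i, 3 ≤ i → i + 3 ≤ 2 * n → i % 2 = 1 → i ∈ S ∨ i + 2 ∈ S := by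
  constructor
  · rintro ⟨h1, h2⟩
    refine ⟨fun i hi => mem_A'.1 (h1 hi), fun i hi hi' hi2 => ?_⟩
    have := h2 (i / 2) (Finset.mem_Icc.2 (by omega))
    rwa [show 2 * (i / 2) + 1 = i by omega, show 2 * (i / 2) + 3 = i + 2 by omega] at this
  · rintro ⟨h1, h2⟩
    refine ⟨fun i hi => mem_A'.2 (h1 i hi), fun k hk => ?_⟩
    rw [Finset.mem_Icc] at hk
    exact h2 (2 * k + 1) (by omega) (by omega) (by omega)

/-- The indices of the variables in an admissible set; `l` and `r` are the choices in `U₂` and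
`U₃`. -/
def zeroIndices (n : ℕ) (S : Finset ℕ) (l r : ℕ) : Set ℕ :=
  {i | i ∈ S ∨ (3 ∉ S ∧ (i = 1 ∨ i = 2)) ∨ (3 ∈ S ∧ 5 ∈ S ∧ i = l) ∨
    (2 * n - 1 ∉ S ∧ (i = 2 * n ∨ i = 2 * n + 1)) ∨
    (2 * n - 1 ∈ S ∧ 2 * n - 3 ∈ S ∧ i = r) ∨
    ∃ a, 5 ≤ a ∧ a + 3 ≤ 2 * n ∧ a % 2 = 1 ∧ ((a - 2 ∈ S ∧ a + 2 ∉ S ∧ i = a + 1) ∨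
      (a - 2 ∉ S ∧ a + 2 ∈ S ∧ i = a - 1))}

/-- The `m` for which `p_{m + 2}` belongs to the admissible sets of `S`. -/
def binomialIndices (S : Finset ℕ) : Set ℕ := {m | m + 2 ∈ S ∧ m ∉ S ∧ m + 4 ∉ S}

/-- The admissible variety of `S` with the choices `l` in `U₂` and `r` in `U₃`. -/
def admissibleLocus (n : ℕ) (S : Finset ℕ) (l r : ℕ) : Set (Vertex n → ℂ) :=
  chainLocus n (zeroIndices n S l r) (binomialIndices S)

/-- The choices of a variable in `U₂` and in `U₃`. -/
def IsChoice (n l r : ℕ) : Prop := (l = 1 ∨ l = 2) ∧ (r = 2 * n ∨ r = 2 * n + 1)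

section

variable {n : ℕ} {S : Finset ℕ} {l r : ℕ}

theorem binomialIndices_bounds (hS : IsFibonacci n S) :
    ∀ m ∈ binomialIndices S, 1 ≤ m ∧ m + 4 ≤ 2 * n + 1 := by
  rw [isFibonacci_iff] at hS
  rintro m ⟨h1, h2, h3⟩
  have := hS.1 _ h1
  omega

theorem zeroIndices_bounds (hn : 3 ≤ n) (hS : IsFibonacci n S) (hc : IsChoice n l r) :
    ∀ i ∈ zeroIndices n S l r, 1 ≤ i ∧ i ≤ 2 * n + 1 := by
  rw [isFibonacci_iff] at hS
  obtain ⟨h1, h2⟩ := hc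
  rintro i (h | h | h | h | h | ⟨a, h⟩)
  · have := hS.1 _ h; omega
  all_goals omega

/-- `p_a` is used only for `a ∈ S` with `a - 2, a + 2 ∉ S`, so `p_{a+2}` is not used as well. A
variable of `p_a` could be killed only if `a ∉ S` or if `a - 2` or `a + 2` were in `S`. -/
theorem isChainData (hn : 3 ≤ n) (hS : IsFibonacci n S) (hc : IsChoice n l r) :
    IsChainData (zeroIndices n S l r) (binomialIndices S) := by
  rw [isFibonacci_iff] at hS
  obtain ⟨hl, hr⟩ := hc
  obtain ⟨hS1, hS2⟩ := hS
  refine ⟨?_, ?_, ?_⟩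
  · rintro m ⟨h1, h2, h3⟩
    have := hS1 _ h1
    omega
  · rintro m ⟨h1, h2, h3⟩ ⟨h4, h5, h6⟩
    exact h3 h4
  · rintro m ⟨h1, h2, h3⟩
    have hm := hS1 _ h1
    refine ⟨?_, ?_, ?_, ?_⟩
    · rintro (h | h | ⟨h, h', h''⟩ | h | h | ⟨a, h⟩)
      · exact h2 h
      · obtain rfl : m = 1 := by omega
        exact h.1 h1
      · obtain rfl : m = 1 := by omega
        exact h3 h'
      all_goals omega
    · rintro (h | h | ⟨h, h', h''⟩ | ⟨h, h'⟩ | h | ⟨a, ha, ha', ha2, ⟨h4, h5, h6⟩ | ⟨h4, h5, h6⟩⟩)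
      · have := hS1 _ h; omega
      · obtain rfl : m = 1 := by omega
        exact h.1 h1
      · obtain rfl : m = 1 := by omega
        exact h3 h'
      · omega
      · omega
      · rw [show a + 2 = m + 2 by omega] at h5; exact h5 h1
      · rw [show a + 2 = m + 4 by omega] at h5; exact h3 h5
    · rintro (h | h | h | ⟨h, h'⟩ | ⟨h, h', h''⟩ | ⟨a, ha, ha', ha2, ⟨h4, h5, h6⟩ | ⟨h4, h5, h6⟩⟩)
      · have := hS1 _ h; omega
      · omega
      · omega
      · rw [show 2 * n - 1 = m + 2 by omega] at h; exact h h1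
      · rw [show 2 * n - 3 = m by omega] at h'; exact h2 h'
      · rw [show a - 2 = m by omega] at h4; exact h2 h4
      · rw [show a - 2 = m + 2 by omega] at h4; exact h4 h1
    · rintro (h | h | h | ⟨h, h'⟩ | ⟨h, h', h''⟩ | ⟨a, h⟩)
      · exact h3 h
      · omega
      · omega
      · rw [show 2 * n - 1 = m + 2 by omega] at h; exact h h1
      · rw [show 2 * n - 3 = m by omega] at h'; exact h2 h'
      · omega

theorem isIrreducibleVariety_admissibleLocus (hn : 3 ≤ n) (hS : IsFibonacci n S)
    (hc : IsChoice n l r) : IsIrreducibleVariety (admissibleLocus n S l r) :=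
  (isChainData hn hS hc).isIrreducibleVariety (binomialIndices_bounds hS)

theorem zeroIndices_subset {S' : Finset ℕ} {l' r' : ℕ} (hn : 3 ≤ n) (hS : IsFibonacci n S)
    (hc : IsChoice n l r) (hS' : IsFibonacci n S') (hc' : IsChoice n l' r')
    (h : admissibleLocus n S l r ⊆ admissibleLocus n S' l' r') :
    zeroIndices n S' l' r' ⊆ zeroIndices n S l r :=
  (isChainData hn hS hc).subset_of_chainLocus_subset (binomialIndices_bounds hS)
    (zeroIndices_bounds hn hS' hc') h

/-- The admissible set of `S` with the choices `l` in `U₂` and `r` in `U₃`. -/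
def admissibleSet (n : ℕ) (S : Finset ℕ) (l r : ℕ) : Set (MvPolynomial (Vertex n) ℂ) :=
  U₁ n S ∪ {f | (3 ∉ S ∧ (f = x n 1 ∨ f = x n 2)) ∨ (3 ∈ S ∧ 5 ∈ S ∧ f = x n l) ∨
    (3 ∈ S ∧ 5 ∉ S ∧ f = p n 3)} ∪
    {f | (2 * n - 1 ∉ S ∧ (f = x n (2 * n) ∨ f = x n (2 * n + 1))) ∨
      (2 * n - 1 ∈ S ∧ 2 * n - 3 ∈ S ∧ f = x n r) ∨
      (2 * n - 1 ∈ S ∧ 2 * n - 3 ∉ S ∧ f = p n (2 * n - 1))} ∪ U₄ n S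

/-- The Fibonacci property gives `5 ∈ S` when `3 ∉ S`, and likewise at the right end, so the three
cases of `U₂` and of `U₃` are exhaustive and one condition can be dropped. -/
theorem isAdmissible_iff (hn : 3 ≤ n) (hS : IsFibonacci n S)
    {B : Set (MvPolynomial (Vertex n) ℂ)} :
    IsAdmissible n S B ↔ ∃ l r, IsChoice n l r ∧ B = admissibleSet n S l r := by
  rw [isFibonacci_iff] at hS
  have h35 : 3 ∈ S ∨ 5 ∈ S := hS.2 3 le_rfl (by omega) rfl
  have hlast : 2 * n - 3 ∈ S ∨ 2 * n - 1 ∈ S := by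
    have := hS.2 (2 * n - 3) (by omega) (by omega) (by omega)
    rwa [show 2 * n - 3 + 2 = 2 * n - 1 by omega] at this
  have hU₂ : ∀ T, IsU₂ n S T ↔ ∃ l, (l = 1 ∨ l = 2) ∧
      T = {f | (3 ∉ S ∧ (f = x n 1 ∨ f = x n 2)) ∨ (3 ∈ S ∧ 5 ∈ S ∧ f = x n l) ∨
        (3 ∈ S ∧ 5 ∉ S ∧ f = p n 3)} := fun T => by
    by_cases h3 : 3 ∈ S <;> by_cases h5 : 5 ∈ S <;> simp_all [IsU₂]; rfl
  have hU₃ : ∀ T, IsU₃ n S T ↔ ∃ r, (r = 2 * n ∨ r = 2 * n + 1) ∧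
      T = {f | (2 * n - 1 ∉ S ∧ (f = x n (2 * n) ∨ f = x n (2 * n + 1))) ∨
      (2 * n - 1 ∈ S ∧ 2 * n - 3 ∈ S ∧ f = x n r) ∨
      (2 * n - 1 ∈ S ∧ 2 * n - 3 ∉ S ∧ f = p n (2 * n - 1))} := fun T => by
    by_cases h3 : 2 * n - 1 ∈ S <;> by_cases h5 : 2 * n - 3 ∈ S <;> simp_all [IsU₃]; rfl
  constructor
  · rintro ⟨T₂, T₃, h2, h3, rfl⟩
    obtain ⟨l, hl, rfl⟩ := (hU₂ _).1 h2
    obtain ⟨r, hr, rfl⟩ := (hU₃ _).1 h3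
    exact ⟨l, r, ⟨hl, hr⟩, rfl⟩
  · rintro ⟨l, r, ⟨hl, hr⟩, rfl⟩
    exact ⟨_, _, (hU₂ _).2 ⟨l, hl, rfl⟩, (hU₃ _).2 ⟨r, hr, rfl⟩, rfl⟩

theorem coord_binomial (v : Vertex n → ℂ) (m : ℕ) : eval v (p n (m + 2)) =
    coord v m * coord v (m + 1) + coord v (m + 3) * coord v (m + 4) := by
  simp [p, coord]

/-- Since 1 and `2 * n + 1` never lie in `S`, the binomials at both ends follow the same pattern as
those of `U₄`; in `U₄` the missing condition `a ∈ S` is supplied by the Fibonacci property. -/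
theorem zeroLocus_span_admissibleSet (hn : 3 ≤ n) (hS : IsFibonacci n S) :
    zeroLocus ℂ (Ideal.span (admissibleSet n S l r)) = admissibleLocus n S l r := by
  rw [isFibonacci_iff] at hS
  obtain ⟨hS1, hS2⟩ := hS
  rw [zeroLocus_span]
  ext v
  simp only [aeval_eq_eval]
  change (∀ f ∈ admissibleSet n S l r, eval v f = 0) ↔ _
  constructor
  · intro h
    refine ⟨fun i hi => ?_, fun m hm => ?_⟩
    · refine h (x n i) ?_
      rcases hi with hi | ⟨h1, hi⟩ | ⟨h1, h2, rfl⟩ | ⟨h1, hi⟩ | ⟨h1, h2, rfl⟩ | ⟨a, h1, h2, h3, ha⟩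
      · exact Or.inl (Or.inl (Or.inl ⟨i, hi, rfl⟩))
      · refine Or.inl (Or.inl (Or.inr (Or.inl ⟨h1, ?_⟩)))
        rcases hi with rfl | rfl <;> simp
      · exact Or.inl (Or.inl (Or.inr (Or.inr (Or.inl ⟨h1, h2, rfl⟩))))
      · refine Or.inl (Or.inr (Or.inl ⟨h1, ?_⟩))
        rcases hi with rfl | rfl <;> simp
      · exact Or.inl (Or.inr (Or.inr (Or.inl ⟨h1, h2, rfl⟩)))
      · refine Or.inr ⟨a, mem_A.2 ⟨h1, h2, h3⟩, ?_⟩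
        rcases ha with ⟨h4, h5, rfl⟩ | ⟨h4, h5, rfl⟩
        · exact Or.inl ⟨h4, h5, rfl⟩
        · exact Or.inr (Or.inl ⟨h4, h5, rfl⟩)
    · rw [← coord_binomial]
      obtain ⟨h1, h2, h3⟩ := hm
      have hb := hS1 _ h1
      refine h _ ?_
      by_cases h4 : m = 1
      · subst h4
        exact Or.inl (Or.inl (Or.inr (Or.inr (Or.inr ⟨h1, h3, rfl⟩))))
      by_cases h5 : m + 3 = 2 * n
      · obtain rfl : m = 2 * n - 3 := by omega
        rw [show 2 * n - 3 + 2 = 2 * n - 1 by omega] at *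
        exact Or.inl (Or.inr (Or.inr (Or.inr ⟨h1, h2, rfl⟩)))
      · exact Or.inr ⟨m + 2, mem_A.2 (by omega), Or.inr (Or.inr ⟨h2, h3, rfl⟩)⟩
  · rintro ⟨hZ, hT⟩ f (((⟨i, hi, rfl⟩ | h) | h) | ⟨a, ha, h⟩)
    · exact hZ i (Or.inl hi)
    · rcases h with ⟨h1, rfl | rfl⟩ | ⟨h1, h2, rfl⟩ | ⟨h1, h2, rfl⟩
      · exact hZ 1 (Or.inr (Or.inl ⟨h1, Or.inl rfl⟩))
      · exact hZ 2 (Or.inr (Or.inl ⟨h1, Or.inr rfl⟩))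
      · exact hZ _ (Or.inr (Or.inr (Or.inl ⟨h1, h2, rfl⟩)))
      · rw [coord_binomial v 1]
        exact hT 1 ⟨h1, fun h => by have := hS1 _ h; omega, h2⟩
    · rcases h with ⟨h1, rfl | rfl⟩ | ⟨h1, h2, rfl⟩ | ⟨h1, h2, rfl⟩
      · exact hZ _ (Or.inr (Or.inr (Or.inr (Or.inl ⟨h1, Or.inl rfl⟩))))
      · exact hZ _ (Or.inr (Or.inr (Or.inr (Or.inl ⟨h1, Or.inr rfl⟩))))
      · exact hZ _ (Or.inr (Or.inr (Or.inr (Or.inr (Or.inl ⟨h1, h2, rfl⟩)))))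
      · rw [show 2 * n - 1 = (2 * n - 3) + 2 by omega] at h1 ⊢
        rw [coord_binomial]
        exact hT _ ⟨h1, h2, fun h => by have := hS1 _ h; omega⟩
    · rw [mem_A] at ha
      rcases h with ⟨h1, h2, rfl⟩ | ⟨h1, h2, rfl⟩ | ⟨h1, h2, rfl⟩
      · exact hZ _ (Or.inr (Or.inr (Or.inr (Or.inr (Or.inr
          ⟨a, ha.1, ha.2.1, ha.2.2, Or.inl ⟨h1, h2, rfl⟩⟩)))))
      · exact hZ _ (Or.inr (Or.inr (Or.inr (Or.inr (Or.inr
          ⟨a, ha.1, ha.2.1, ha.2.2, Or.inr ⟨h1, h2, rfl⟩⟩)))))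
      · obtain ⟨m, rfl⟩ : ∃ m, a = m + 2 := ⟨a - 2, by omega⟩
        rw [coord_binomial]
        refine hT m ⟨?_, h1, h2⟩
        exact (hS2 m (by omega) (by omega) (by omega)).resolve_left h1

end

end LoosePath

namespace LoosePath

/-! ### Covering the nullvariety, inclusions and maximality. -/

open MvPolynomial

section

variable {n : ℕ} {S S' : Finset ℕ} {l r l' r' : ℕ}

theorem mem_of_mem_zeroIndices_of_odd (hc : IsChoice n l r) {i : ℕ} (h3 : 3 ≤ i)
    (hi : i + 1 ≤ 2 * n) (h2 : i % 2 = 1) (h : i ∈ zeroIndices n S l r) : i ∈ S := by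
  obtain ⟨hl, hr⟩ := hc
  rcases h with h | h | h | h | h | ⟨a, h⟩
  · exact h
  all_goals omega

theorem mem_nullvariety_of_mem_admissibleLocus (hn : 3 ≤ n) (hS : IsFibonacci n S)
    (hc : IsChoice n l r) {v : Vertex n → ℂ} (hv : v ∈ admissibleLocus n S l r) :
    v ∈ nullvariety n := by
  rw [isFibonacci_iff] at hS
  obtain ⟨hS1, hS2⟩ := hS
  obtain ⟨hl, hr⟩ := hc
  obtain ⟨hZ, hT⟩ := hv
  have h35 : 3 ∈ S ∨ 5 ∈ S := hS2 3 le_rfl (by omega) rfl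
  have zS : ∀ i ∈ S, coord v i = 0 := fun i hi => hZ i (Or.inl hi)
  have z1 : 3 ∉ S → coord v 1 = 0 := fun h => hZ 1 (Or.inr (Or.inl ⟨h, Or.inl rfl⟩))
  have z2 : 3 ∉ S → coord v 2 = 0 := fun h => hZ 2 (Or.inr (Or.inl ⟨h, Or.inr rfl⟩))
  have zn : 2 * n - 1 ∉ S → coord v (2 * n) = 0 := fun h =>
    hZ _ (Or.inr (Or.inr (Or.inr (Or.inl ⟨h, Or.inl rfl⟩))))
  have zn' : 2 * n - 1 ∉ S → coord v (2 * n + 1) = 0 := fun h =>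
    hZ _ (Or.inr (Or.inr (Or.inr (Or.inl ⟨h, Or.inr rfl⟩))))
  have z12 : 5 ∈ S → coord v 1 * coord v 2 = 0 := fun h5 => by
    by_cases h3 : 3 ∈ S
    · have := hZ l (Or.inr (Or.inr (Or.inl ⟨h3, h5, rfl⟩)))
      rcases hl with rfl | rfl <;> simp [this]
    · rw [z1 h3, zero_mul]
  have znn : 2 * n - 3 ∈ S → coord v (2 * n) * coord v (2 * n + 1) = 0 := fun h5 => by
    by_cases h3 : 2 * n - 1 ∈ S
    · have := hZ r (Or.inr (Or.inr (Or.inr (Or.inr (Or.inl ⟨h3, h5, rfl⟩)))))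
      rcases hr with rfl | rfl <;> simp [this]
    · rw [zn h3, zero_mul]
  rw [mem_nullvariety_iff (by omega)]
  refine ⟨fun j h1 h2 => ?_, ?_, ?_, fun j h1 h2 => ?_⟩
  · rcases eq_or_lt_of_le h1 with rfl | h1
    · by_cases h3 : 3 ∈ S
      · rw [zS _ h3, mul_zero]
      · rw [z1 h3, zero_mul]
    rcases eq_or_lt_of_le h2 with rfl | h2
    · by_cases h3 : 2 * j - 1 ∈ S
      · rw [zS _ h3, zero_mul]
      · rw [zn' h3, mul_zero]
    rcases hS2 (2 * j - 1) (by omega) (by omega) (by omega) with h | h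
    · rw [zS _ h, zero_mul]
    · rw [show 2 * j - 1 + 2 = 2 * j + 1 by omega] at h
      rw [zS _ h, mul_zero]
  · by_cases h3 : 3 ∈ S
    · rw [zS _ h3, mul_zero]
    · rw [z2 h3, zero_mul]
  · by_cases h3 : 2 * n - 1 ∈ S
    · rw [zS _ h3, zero_mul]
    · rw [zn h3, mul_zero]
  · obtain ⟨m, hm⟩ : ∃ m, 2 * j - 1 = m := ⟨_, rfl⟩
    rw [hm, show 2 * j = m + 1 by omega, show m + 1 + 2 = m + 3 by rfl,
      show m + 1 + 3 = m + 4 by rfl]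
    -- If one outer variable is indexed by `S`, its term vanishes and the other term contains a
    -- variable killed by `U₂`, `U₃` or `U₄`; if neither is, the binomial itself is among the
    -- equations.
    by_cases h0 : m ∈ S <;> by_cases h4 : m + 4 ∈ S
    · rw [zS _ h0, zS _ h4]; ring
    · suffices h : coord v (m + 3) * coord v (m + 4) = 0 by rw [zS _ h0, h]; ring
      by_cases hmn : m + 3 = 2 * n
      · rw [show m = 2 * n - 3 by omega] at h0
        rw [hmn, show m + 4 = 2 * n + 1 by omega]
        exact znn h0
      · have := hS1 _ h0
        rw [hZ (m + 3) (Or.inr (Or.inr (Or.inr (Or.inr (Or.inr ⟨m + 2, by omega, by omega, by omega,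
          Or.inl ⟨h0, h4, rfl⟩⟩))))), zero_mul]
    · suffices h : coord v m * coord v (m + 1) = 0 by rw [zS _ h4, h]; ring
      by_cases hm1 : m = 1
      · subst hm1
        exact z12 h4
      · have := hS1 _ h4
        rw [hZ (m + 1) (Or.inr (Or.inr (Or.inr (Or.inr (Or.inr ⟨m + 2, by omega, by omega, by omega,
          Or.inr ⟨h0, h4, rfl⟩⟩))))), mul_zero]
    · refine hT m ⟨?_, h0, h4⟩
      by_cases hm1 : m = 1
      · subst hm1
        exact h35.resolve_right h4
      · exact (hS2 m (by omega) (by omega) (by omega)).resolve_left h0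

theorem exists_mem_admissibleLocus (hn : 3 ≤ n) {v : Vertex n → ℂ} (hv : v ∈ nullvariety n) :
    ∃ S l r, IsFibonacci n S ∧ IsChoice n l r ∧ v ∈ admissibleLocus n S l r := by
  classical
  rw [mem_nullvariety_iff (by omega)] at hv
  obtain ⟨hE, hL, hR, hp⟩ := hv
  have hbin : ∀ m, 1 ≤ m → m + 3 ≤ 2 * n → m % 2 = 1 →
      coord v m * coord v (m + 1) + coord v (m + 3) * coord v (m + 4) = 0 := fun m h1 h2 h3 => by
    obtain ⟨j, rfl⟩ : ∃ j, m = 2 * j + 1 := ⟨m / 2, by omega⟩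
    have := hp (j + 1) (by omega) (by omega)
    rwa [show 2 * (j + 1) - 1 = 2 * j + 1 by omega, show 2 * (j + 1) = 2 * j + 1 + 1 by ring] at this
  -- Taking all vanishing inner odd coordinates makes those outside `S` nonzero, so they can be
  -- cancelled from the remaining equations.
  let S := (A' n).filter fun i => coord v i = 0
  have hS : ∀ i, 3 ≤ i → i + 1 ≤ 2 * n → i % 2 = 1 → (i ∈ S ↔ coord v i = 0) := fun i h1 h2 h3 => by
    simp [S, mem_A', h1, h2, h3]
  have hSb : ∀ i ∈ S, 3 ≤ i ∧ i + 1 ≤ 2 * n ∧ i % 2 = 1 := fun i hi =>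
    mem_A'.1 (Finset.mem_filter.1 hi).1
  have hS0 : ∀ i ∈ S, coord v i = 0 := fun i hi => (Finset.mem_filter.1 hi).2
  refine ⟨S, if coord v 1 = 0 then 1 else 2, if coord v (2 * n) = 0 then 2 * n else 2 * n + 1,
    isFibonacci_iff.2 ⟨hSb, fun i h1 h2 h3 => ?_⟩, ⟨?_, ?_⟩, ?_, ?_⟩
  · rw [hS i h1 (by omega) h3, hS (i + 2) (by omega) (by omega) (by omega), ← mul_eq_zero]
    have := hE (i / 2 + 1) (by omega) (by omega)
    rwa [show 2 * (i / 2 + 1) - 1 = i by omega, show 2 * (i / 2 + 1) + 1 = i + 2 by omega] at this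
  · split_ifs <;> simp
  · split_ifs <;> simp
  · rintro i (h | ⟨h, h'⟩ | ⟨h3, h5, rfl⟩ | ⟨h, h'⟩ | ⟨h3, h5, rfl⟩ |
      ⟨a, ha, ha', ha2, ⟨h4, h5, rfl⟩ | ⟨h4, h5, rfl⟩⟩)
    · exact hS0 i h
    · rw [hS 3 (by omega) (by omega) (by omega)] at h
      have := hE 1 le_rfl (by omega)
      rcases h' with rfl | rfl
      · exact (mul_eq_zero.1 this).resolve_right h
      · exact (mul_eq_zero.1 hL).resolve_right h
    · have := hbin 1 (by omega) (by omega) (by omega)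
      split_ifs with h1
      · exact h1
      · rw [show 1 + 4 = 5 by rfl, hS0 5 h5, mul_zero, add_zero] at this
        exact (mul_eq_zero.1 this).resolve_left h1
    · rw [hS _ (by omega) (by omega) (by omega)] at h
      have := hE n (by omega) le_rfl
      rcases h' with rfl | rfl
      · exact (mul_eq_zero.1 hR).resolve_left h
      · exact (mul_eq_zero.1 this).resolve_left h
    · have := hbin (2 * n - 3) (by omega) (by omega) (by omega)
      split_ifs with h1
      · exact h1
      · rw [hS0 _ h5, zero_mul, zero_add, show 2 * n - 3 + 3 = 2 * n by omega,
          show 2 * n - 3 + 4 = 2 * n + 1 by omega] at this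
        exact (mul_eq_zero.1 this).resolve_left h1
    · have := hbin (a - 2) (by omega) (by omega) (by omega)
      rw [hS _ (by omega) (by omega) (by omega)] at h5
      rw [hS0 _ h4, zero_mul, zero_add, show a - 2 + 3 = a + 1 by omega,
          show a - 2 + 4 = a + 2 by omega] at this
      exact (mul_eq_zero.1 this).resolve_right h5
    · have := hbin (a - 2) (by omega) (by omega) (by omega)
      rw [hS _ (by omega) (by omega) (by omega)] at h4
      rw [show a - 2 + 4 = a + 2 by omega, hS0 _ h5, mul_zero, add_zero,
        show a - 2 + 1 = a - 1 by omega] at this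
      exact (mul_eq_zero.1 this).resolve_left h4
  · rintro m ⟨h1, -, -⟩
    have := hSb _ h1
    exact hbin m (by omega) (by omega) (by omega)

/-- The binomials of `S'` impose nothing new: the smaller locus lies in the nullvariety, where every
`p_a` vanishes. -/
theorem admissibleLocus_subset_iff (hn : 3 ≤ n) (hS : IsFibonacci n S)
    (hc : IsChoice n l r) (hS' : IsFibonacci n S') (hc' : IsChoice n l' r') :
    admissibleLocus n S l r ⊆ admissibleLocus n S' l' r' ↔
      zeroIndices n S' l' r' ⊆ zeroIndices n S l r := by
  refine ⟨zeroIndices_subset hn hS hc hS' hc', fun h v hv => ⟨fun i hi => hv.1 i (h hi), ?_⟩⟩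
  have hv0 := (mem_nullvariety_iff (by omega)).1
    (mem_nullvariety_of_mem_admissibleLocus hn hS hc hv)
  intro m hm
  have hb := binomialIndices_bounds hS' m hm
  have h2 := (isChainData hn hS' hc').odd m hm
  have := hv0.2.2.2 (m / 2 + 1) (by omega) (by omega)
  rwa [show 2 * (m / 2 + 1) - 1 = m by omega, show 2 * (m / 2 + 1) = m + 1 by omega] at this

/-- Removing every second element of a maximal run of odd length at least `3` gives a Fibonacci
subset with a larger variety. -/
theorem exists_zeroIndices_ssubset (hS : IsFibonacci n S) (hc : IsChoice n l r)
    (hruns : ¬ HasSingletonOrEvenRuns S) :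
    ∃ S', IsFibonacci n S' ∧ zeroIndices n S' l r ⊂ zeroIndices n S l r := by
  simp only [HasSingletonOrEvenRuns, not_forall, not_or, Nat.not_even_iff_odd] at hruns
  obtain ⟨a, m, ⟨hodd, hm, hrun, hleft, hright⟩, hm1, hmo⟩ := hruns
  rw [Nat.odd_iff] at hodd hmo
  rw [isFibonacci_iff] at hS
  obtain ⟨hS1, hS2⟩ := hS
  have hR : ∀ i, a ≤ i → i < a + 2 * m → i % 2 = 1 → i ∈ S := fun i h1 h2 h3 => by
    have := hrun ((i - a) / 2) (by omega)
    rwa [show a + 2 * ((i - a) / 2) = i by omega] at this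
  have ha := hS1 a (hR a le_rfl (by omega) hodd)
  -- The removed elements are `a + 2, a + 6, …`. As `m` is odd, both ends of the run survive.
  let P : ℕ → Prop := fun i => a < i ∧ i < a + 2 * m ∧ i % 4 = (a + 2) % 4
  have hmem : ∀ i, i ∈ S.filter (fun i => ¬(a < i ∧ i < a + 2 * m ∧ i % 4 = (a + 2) % 4)) ↔
      i ∈ S ∧ ¬ P i := fun i => Finset.mem_filter
  generalize S.filter (fun i => ¬(a < i ∧ i < a + 2 * m ∧ i % 4 = (a + 2) % 4)) = S' at hmem
  have hsub : ∀ i ∈ S', i ∈ S := fun i hi => ((hmem i).1 hi).1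
  refine ⟨S', isFibonacci_iff.2 ⟨fun i hi => hS1 i (hsub i hi), fun i h1 h2 h3 => ?_⟩, ?_⟩
  · rw [hmem, hmem]
    by_cases hi : P i
    · obtain ⟨h4, h5, h6⟩ := hi
      exact Or.inr ⟨hR _ (by omega) (by omega) (by omega), fun h => by have := h.2.2; omega⟩
    by_cases hi2 : P (i + 2)
    · obtain ⟨h4, h5, h6⟩ := hi2
      exact Or.inl ⟨hR _ (by omega) (by omega) (by omega), hi⟩
    · rcases hS2 i h1 h2 h3 with h | h
      exacts [Or.inl ⟨h, hi⟩, Or.inr ⟨h, hi2⟩]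
  rw [Set.ssubset_iff_of_subset]
  · have h2 := hR (a + 2) (by omega) (by omega) (by omega)
    refine ⟨a + 2, Or.inl h2, fun h => ?_⟩
    have hb := hS1 _ h2
    have := mem_of_mem_zeroIndices_of_odd hc hb.1 hb.2.1 hb.2.2 h
    exact ((hmem _).1 this).2 ⟨by omega, by omega, rfl⟩
  rintro i (h | ⟨h, h'⟩ | ⟨h3, h5, rfl⟩ | ⟨h, h'⟩ | ⟨h3, h5, rfl⟩ |
      ⟨c, hc5, hc', hc2, ⟨h4, h5, h6⟩ | ⟨h4, h5, h6⟩⟩)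
  · exact Or.inl (hsub i h)
  · refine Or.inr (Or.inl ⟨fun h3 => h ((hmem 3).2 ⟨h3, fun hP => ?_⟩), h'⟩)
    have := hP.1
    omega
  · exact Or.inr (Or.inr (Or.inl ⟨hsub _ h3, hsub _ h5, rfl⟩))
  · refine Or.inr (Or.inr (Or.inr (Or.inl ⟨fun h3 => h ((hmem _).2 ⟨h3, fun hP => ?_⟩), h'⟩)))
    obtain ⟨h7, h8, h9⟩ := hP
    have := hS1 _ (hR (2 * n + 1) (by omega) (by omega) (by omega))
    omega
  · exact Or.inr (Or.inr (Or.inr (Or.inr (Or.inl ⟨hsub _ h3, hsub _ h5, rfl⟩))))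
  · refine Or.inr (Or.inr (Or.inr (Or.inr (Or.inr ⟨c, hc5, hc', hc2, Or.inl ⟨hsub _ h4, ?_, h6⟩⟩))))
    intro hcS
    have hP : P (c + 2) := by
      by_contra hP
      exact h5 ((hmem _).2 ⟨hcS, hP⟩)
    obtain ⟨h7, h8, h9⟩ := hP
    -- Removed elements are four apart, so `c - 2` is removed along with `c + 2`, unless `c` is the
    -- left end of the run, where `c - 2` was never in `S`.
    by_cases hca : c = a
    · exact hleft (c - 2) (by omega) (hsub _ h4)
    · exact ((hmem _).1 h4).2 ⟨by omega, by omega, by omega⟩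
  · refine Or.inr (Or.inr (Or.inr (Or.inr (Or.inr ⟨c, hc5, hc', hc2, Or.inr ⟨?_, hsub _ h5, h6⟩⟩))))
    intro hcS
    have hP : P (c - 2) := by
      by_contra hP
      exact h4 ((hmem _).2 ⟨hcS, hP⟩)
    obtain ⟨h7, h8, h9⟩ := hP
    by_cases hca : c + 2 < a + 2 * m
    · exact ((hmem _).1 h5).2 ⟨by omega, by omega, by omega⟩
    · rw [show a + 2 * m = c + 2 by omega] at hright
      exact hright (hsub _ h5)

/-- If all maximal runs of `S` are singletons or have even length, then `S` is determined by any
variety containing one of the varieties of `S`. -/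
theorem eq_of_zeroIndices_subset (hn : 3 ≤ n) (hS : IsFibonacci n S) (hc : IsChoice n l r)
    (hruns : HasSingletonOrEvenRuns S) (hS' : IsFibonacci n S')
    (h : zeroIndices n S' l' r' ⊆ zeroIndices n S l r) : S' = S := by
  have hc0 := hc
  obtain ⟨hl, hr⟩ := hc
  rw [isFibonacci_iff] at hS hS'
  obtain ⟨hS1, hS2⟩ := hS
  obtain ⟨hS1', hS2'⟩ := hS'
  have hsub : ∀ i ∈ S', i ∈ S := fun i hi =>
    have hb := hS1' i hi
    mem_of_mem_zeroIndices_of_odd hc0 hb.1 hb.2.1 hb.2.2 (h (Or.inl hi))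
  -- The variable between two consecutive elements of `S` is not killed, so `S'` must not kill it
  -- either. This propagates membership in `S'` along a run in steps of 4.
  have inner : ∀ b, b % 2 = 1 → 3 ≤ b → b + 3 ≤ 2 * n → b ∈ S → b + 2 ∈ S →
      b + 1 ∉ zeroIndices n S l r := by
    rintro b h1 h2 h3 h4 h5 (h | h | h | h | h | ⟨a, ha, ha', ha2, ⟨h6, h7, h8⟩ | ⟨h6, h7, h8⟩⟩)
    · have := hS1 _ h; omega
    · omega
    · omega
    · omega
    · omega
    · rw [show a + 2 = b + 2 by omega] at h7; exact h7 h5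
    · rw [show a - 2 = b by omega] at h6; exact h6 h4
  have stepR : ∀ b, b ∈ S' → b + 2 ∈ S → b + 4 ∈ S → b + 4 ∈ S' := fun b h0 h2 h4 => by
    by_contra h4'
    have hb := hS1' b h0
    have hb4 := hS1 _ h4
    exact inner (b + 2) (by omega) (by omega) (by omega) h2 h4
      (h (Or.inr (Or.inr (Or.inr (Or.inr (Or.inr ⟨b + 2, by omega, by omega, by omega,
        Or.inl ⟨h0, h4', rfl⟩⟩))))))
  have stepL : ∀ b, b ∈ S → b + 2 ∈ S → b + 4 ∈ S' → b ∈ S' := fun b h0 h2 h4 => by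
    by_contra h0'
    have hb := hS1 b h0
    have hb4 := hS1' _ h4
    exact inner b (by omega) (by omega) (by omega) h0 h2
      (h (Or.inr (Or.inr (Or.inr (Or.inr (Or.inr ⟨b + 2, by omega, by omega, by omega,
        Or.inr ⟨h0', h4, rfl⟩⟩))))))
  -- If `3 ∉ S'`, both `x_1` and `x_2` are killed for `S'`, but with `3 ∈ S` at most `x_l` is killed
  -- for `S`.
  have endL : 3 ∈ S → 3 ∈ S' := fun h3 => by
    by_contra h3'
    have e : ∀ i, i = 1 ∨ i = 2 → i = l := fun i hi => by
      rcases h (Or.inr (Or.inl ⟨h3', hi⟩)) with h | h | h | h | h | ⟨a, h⟩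
      · have := hS1 _ h; omega
      · exact absurd h3 h.1
      · exact h.2.2
      all_goals omega
    have := e 1 (Or.inl rfl)
    have := e 2 (Or.inr rfl)
    omega
  have endR : 2 * n - 1 ∈ S → 2 * n - 1 ∈ S' := fun h3 => by
    by_contra h3'
    have e : ∀ i, i = 2 * n ∨ i = 2 * n + 1 → i = r := fun i hi => by
      rcases h (Or.inr (Or.inr (Or.inr (Or.inl ⟨h3', hi⟩)))) with h | h | h | h | h | ⟨a, h⟩
      · have := hS1 _ h; omega
      · omega
      · omega
      · exact absurd h3 h.1
      · exact h.2.2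
      · omega
    have := e _ (Or.inl rfl)
    have := e _ (Or.inr rfl)
    omega
  have runL : ∀ b, b ∈ S → b ∉ S' → ∃ a j, b = a + 2 * (2 * j + 1) ∧
      (∀ k ≤ 2 * j + 1, a + 2 * k ∈ S) ∧ ∀ c, c + 2 = a → c ∉ S := by
    intro b
    induction b using Nat.strong_induction_on with
    | _ b ih =>
      intro hb hb'
      have hbb := hS1 b hb
      have hb3 : b ≠ 3 := by rintro rfl; exact hb' (endL hb)
      obtain ⟨d, rfl⟩ : ∃ d, b = d + 4 := ⟨b - 4, by omega⟩
      have hd2 : d + 2 ∈ S' := (hS2' (d + 2) (by omega) (by omega) (by omega)).resolve_right hb'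
      by_cases hd : d ∈ S
      · obtain ⟨a, j, rfl, hk, ha⟩ := ih d (by omega) hd fun h => hb' (stepR d h (hsub _ hd2) hb)
        refine ⟨a, j + 1, by ring, fun k hk' => ?_, ha⟩
        rcases (show k ≤ 2 * j + 1 ∨ k = 2 * j + 2 ∨ k = 2 * j + 3 by omega) with h | rfl | rfl
        · exact hk k h
        · convert hsub _ hd2 using 1; ring
        · convert hb using 1; ring
      · refine ⟨d + 2, 0, by ring, fun k hk' => ?_, fun c hc => ?_⟩
        · rcases (show k = 0 ∨ k = 1 by omega) with rfl | rfl
          exacts [hsub _ hd2, hb]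
        · rwa [show c = d by omega]
  have runR : ∀ t b, b + t = 2 * n → b ∈ S → b ∉ S' → ∃ j,
      (∀ k ≤ 2 * j + 1, b + 2 * k ∈ S) ∧ b + 2 * (2 * j + 2) ∉ S := by
    intro t
    induction t using Nat.strong_induction_on with
    | _ t ih =>
      intro b hbt hb hb'
      have hbb := hS1 b hb
      have hbn : b ≠ 2 * n - 1 := by rintro rfl; exact hb' (endR hb)
      have hd2 : b + 2 ∈ S' := (hS2' b (by omega) (by omega) (by omega)).resolve_left hb'
      by_cases hd : b + 4 ∈ S
      · have := hS1 _ hd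
        obtain ⟨j, hk, hj⟩ := ih (t - 4) (by omega) (b + 4) (by omega) hd
          fun h => hb' (stepL b hb (hsub _ hd2) h)
        refine ⟨j + 1, fun k hk' => ?_, by convert hj using 2; ring⟩
        rcases (show k = 0 ∨ k = 1 ∨ 2 ≤ k by omega) with rfl | rfl | h
        · exact hb
        · exact hsub _ hd2
        · convert hk (k - 2) (by omega) using 1; omega
      · refine ⟨0, fun k hk' => ?_, hd⟩
        rcases (show k = 0 ∨ k = 1 by omega) with rfl | rfl
        exacts [hb, hsub _ hd2]
  refine Finset.Subset.antisymm (fun i hi => hsub i hi) fun b hb => ?_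
  by_contra hb'
  have hbb := hS1 b hb
  obtain ⟨a, j, hab, hk, ha⟩ := runL b hb hb'
  obtain ⟨j', hk', hj'⟩ := runR (2 * n - b) b (by omega) hb hb'
  -- An odd number on the left, an odd number on the right and `b` itself: the run has odd length at
  -- least 3, which is excluded.
  have hrun := hruns a (2 * j + 1 + (2 * j' + 1) + 1) ⟨Nat.odd_iff.2 (by omega), by omega,
    fun k hkm => ?_, ha, ?_⟩
  · rw [Nat.even_iff] at hrun
    omega
  · rcases le_or_gt k (2 * j + 1) with h | h
    · exact hk k h
    · convert hk' (k - (2 * j + 1)) (by omega) using 1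
      omega
  · convert hj' using 2
    omega

/-- For a fixed `S` only the choices differ, and a choice that is used kills exactly one of two
variables. Hence varieties of the same `S` are equal or incomparable. -/
theorem zeroIndices_subset_of_subset (hn : 3 ≤ n) (hS : IsFibonacci n S) (hc : IsChoice n l r)
    (hc' : IsChoice n l' r') (h : zeroIndices n S l' r' ⊆ zeroIndices n S l r) :
    zeroIndices n S l r ⊆ zeroIndices n S l' r' := by
  obtain ⟨hl, hr⟩ := hc
  obtain ⟨hl', hr'⟩ := hc'
  have hS1 := (isFibonacci_iff.1 hS).1
  rintro i (hi | hi | ⟨h3, h5, rfl⟩ | hi | ⟨h3, h5, rfl⟩ | hi)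
  · exact Or.inl hi
  · exact Or.inr (Or.inl hi)
  · have : l' = i := by
      rcases h (Or.inr (Or.inr (Or.inl ⟨h3, h5, rfl⟩))) with h | h | h | h | h | ⟨a, h⟩
      · have := hS1 _ h; omega
      · exact absurd h3 h.1
      · exact h.2.2
      all_goals omega
    exact Or.inr (Or.inr (Or.inl ⟨h3, h5, this.symm⟩))
  · exact Or.inr (Or.inr (Or.inr (Or.inl hi)))
  · have : r' = i := by
      rcases h (Or.inr (Or.inr (Or.inr (Or.inr (Or.inl ⟨h3, h5, rfl⟩))))) with
        h | h | h | h | h | ⟨a, h⟩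
      · have := hS1 _ h; omega
      · omega
      · omega
      · exact absurd h3 h.1
      · exact h.2.2
      · omega
    exact Or.inr (Or.inr (Or.inr (Or.inr (Or.inl ⟨h3, h5, this.symm⟩))))
  · exact Or.inr (Or.inr (Or.inr (Or.inr (Or.inr hi))))

theorem mem_admissibleVarieties_iff (hn : 3 ≤ n) {W : Set (Vertex n → ℂ)} :
    W ∈ admissibleVarieties n ↔
      ∃ S l r, IsFibonacci n S ∧ IsChoice n l r ∧ W = admissibleLocus n S l r := by
  constructor
  · rintro ⟨_, ⟨S, B, hS, hB, rfl⟩, rfl⟩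
    obtain ⟨l, r, hc, rfl⟩ := (isAdmissible_iff hn hS).1 hB
    exact ⟨S, l, r, hS, hc, zeroLocus_span_admissibleSet hn hS⟩
  · rintro ⟨S, l, r, hS, hc, rfl⟩
    exact ⟨_, ⟨S, _, hS, (isAdmissible_iff hn hS).2 ⟨l, r, hc, rfl⟩, rfl⟩,
      (zeroLocus_span_admissibleSet hn hS).symm⟩

theorem finite_admissibleVarieties (hn : 3 ≤ n) : (admissibleVarieties n).Finite := by
  refine (((A' n).powerset ×ˢ ({1, 2} : Finset ℕ) ×ˢ
    ({2 * n, 2 * n + 1} : Finset ℕ)).finite_toSet.image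
    fun q => admissibleLocus n q.1 q.2.1 q.2.2).subset fun W hW => ?_
  obtain ⟨S, l, r, hS, ⟨hl, hr⟩, rfl⟩ := (mem_admissibleVarieties_iff hn).1 hW
  refine ⟨(S, l, r), ?_, rfl⟩
  simp only [Finset.coe_product, Set.mem_prod, Finset.mem_coe, Finset.mem_powerset,
    Finset.mem_insert, Finset.mem_singleton]
  exact ⟨hS.1, hl, hr⟩

theorem isAffineVariety_of_mem_admissibleVarieties {W : Set (Vertex n → ℂ)}
    (hW : W ∈ admissibleVarieties n) : IsAffineVariety W := by
  obtain ⟨I, -, rfl⟩ := hW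
  exact ⟨I, rfl⟩

theorem nullvariety_eq_biUnion (hn : 3 ≤ n) :
    nullvariety n = ⋃ W ∈ admissibleVarieties n, W := by
  ext v
  simp only [Set.mem_iUnion, exists_prop]
  constructor
  · intro hv
    obtain ⟨S, l, r, hS, hc, h⟩ := exists_mem_admissibleLocus hn hv
    exact ⟨_, (mem_admissibleVarieties_iff hn).2 ⟨S, l, r, hS, hc, rfl⟩, h⟩
  · rintro ⟨W, hW, hv⟩
    obtain ⟨S, l, r, hS, hc, rfl⟩ := (mem_admissibleVarieties_iff hn).1 hW
    exact mem_nullvariety_of_mem_admissibleLocus hn hS hc hv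

theorem maximal_admissibleLocus_iff (hn : 3 ≤ n) (hS : IsFibonacci n S) (hc : IsChoice n l r) :
    Maximal (fun W => W ∈ admissibleVarieties n) (admissibleLocus n S l r) ↔
      HasSingletonOrEvenRuns S := by
  constructor
  · intro hmax
    by_contra hruns
    obtain ⟨S', hS', hlt⟩ := exists_zeroIndices_ssubset hS hc hruns
    have hle := hmax.2 ((mem_admissibleVarieties_iff hn).2 ⟨S', l, r, hS', hc, rfl⟩)
      ((admissibleLocus_subset_iff hn hS hc hS' hc).2 hlt.1)
    exact hlt.2 ((admissibleLocus_subset_iff hn hS' hc hS hc).1 hle)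
  · intro hruns
    refine ⟨(mem_admissibleVarieties_iff hn).2 ⟨S, l, r, hS, hc, rfl⟩, fun W hW hle => ?_⟩
    obtain ⟨S', l', r', hS', hc', rfl⟩ := (mem_admissibleVarieties_iff hn).1 hW
    have hZ := (admissibleLocus_subset_iff hn hS hc hS' hc').1 hle
    obtain rfl := eq_of_zeroIndices_subset hn hS hc hruns hS' hZ
    exact (admissibleLocus_subset_iff hn hS hc' hS hc).2
      (zeroIndices_subset_of_subset hn hS hc hc' hZ)

end

end LoosePath

/-! ### The main theorem. -/

theorem mainTheorem3 (n : ℕ) (hn : 3 ≤ n) :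
    LoosePath.nullvariety n =
        (⋃ J ∈ LoosePath.componentIdeals n, MvPolynomial.zeroLocus ℂ J) ∧
    (∀ J ∈ LoosePath.componentIdeals n,
      LoosePath.IsIrreducibleComponent (MvPolynomial.zeroLocus ℂ J)
        (LoosePath.nullvariety n)) ∧
    LoosePath.componentIdeals n =
      {J | ∃ S B, LoosePath.IsFibonacci n S ∧ LoosePath.HasSingletonOrEvenRuns S ∧
        LoosePath.IsAdmissible n S B ∧ J = Ideal.span B} := by
  open LoosePath MvPolynomial in
  have hfin := finite_admissibleVarieties hn
  refine ⟨?_, ?_, ?_⟩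
  · ext v
    rw [nullvariety_eq_biUnion hn]
    simp only [Set.mem_iUnion, exists_prop]
    constructor
    · rintro ⟨W, hW, hv⟩
      obtain ⟨W', hle, hmax⟩ := hfin.exists_le_maximal hW
      obtain ⟨J, hJ, rfl⟩ := hmax.1
      exact ⟨J, ⟨hJ, hmax⟩, hle hv⟩
    · rintro ⟨J, ⟨hJ, -⟩, hv⟩
      exact ⟨_, ⟨J, hJ, rfl⟩, hv⟩
  · rintro J ⟨hJ, hmax⟩
    refine ⟨⟨?_, ?_⟩, fun W hW hle => ?_⟩
    · obtain ⟨S, l, r, hS, hc, h⟩ := (mem_admissibleVarieties_iff hn).1 hmax.1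
      rw [h]
      exact isIrreducibleVariety_admissibleLocus hn hS hc
    · rw [nullvariety_eq_biUnion hn]
      exact Set.subset_biUnion_of_mem (u := fun W => W) hmax.1
    · obtain ⟨V, hV, hWV⟩ := hW.1.exists_subset hfin
        (fun V hV => isAffineVariety_of_mem_admissibleVarieties hV)
        (nullvariety_eq_biUnion hn ▸ hW.2)
      exact hWV.trans (hmax.2 hV (hle.trans hWV))
  · ext J
    constructor
    · rintro ⟨⟨S, B, hS, hB, rfl⟩, hmax⟩
      refine ⟨S, B, hS, ?_, hB, rfl⟩
      obtain ⟨l, r, hc, rfl⟩ := (isAdmissible_iff hn hS).1 hB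
      rw [zeroLocus_span_admissibleSet hn hS] at hmax
      exact (maximal_admissibleLocus_iff hn hS hc).1 hmax
    · rintro ⟨S, B, hS, hruns, hB, rfl⟩
      refine ⟨⟨S, B, hS, hB, rfl⟩, ?_⟩
      obtain ⟨l, r, hc, rfl⟩ := (isAdmissible_iff hn hS).1 hB
      rw [zeroLocus_span_admissibleSet hn hS]
      exact (maximal_admissibleLocus_iff hn hS hc).2 hruns
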